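/- **Setting.** All quantum registers are finite-dimensional and $\log$ is to base $2$. A $t$-round quantum protocol $\Pi$ with shared entanglement ($t\ge 2$ even) on classical inputs $x\in\mathcal X$ (Alice) and $y\in\mathcal Y$ (Bob) is the following. Alice and Bob share a pure state $|\Theta_0\rangle_{A_0B_0}$ that does not depend on the inputs. In every odd round $r$ Alice applies a unitary $A_{r-1}C_{r-1}\to A_rC_r$ controlled by $x$ and sends the message register $C_r$ to Bob, with $B_r=B_{r-1}$; in every even round $r$ Bob applies a unitary $C_{r-1}B_{r-1}\to C_rB_r$ controlled by $y$ and sends $C_r$ to Alice, with $A_r=A_{r-1}$ ($C_0$ is trivial). After round $t$ Alice performs a two-outcome measurement, which may depend on $x$, on $A_tC_t$ and outputs the resulting bit $O(x,y)$. The worst-case error of $\Pi$ for $F:\mathcal X\times\mathcal Y\to\{0,1\}$ is $\max_{x,y}\Pr[O(x,y)\ne F(x,y)]$. Let $|\Theta_r^{x,y}\rangle_{A_rC_rB_r}$ be the state after round $r$ on input $(x,y)$ and, for a distribution $\nu$ on $\mathcal X\times\mathcal Y$, let $$|\Psi_r\rangle_{XR_XYR_YA_rC_rB_r}=\sum_{x,y}\sqrt{\nu(x,y)}\,|xxyy\rangle_{XR_XYR_Y}|\Theta_r^{x,y}\rangle_{A_rC_rB_r}.$$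 The cumulative Holevo information cost of $\Pi$ under $\nu$ is $$\mathrm{HQIC}(\Pi,\nu)=\sum_{1\le r\le t,\ r\text{ odd}} \mathrm I(X:B_rC_r\,|\,Y)_{\Psi_r}+\sum_{1\le r\le t,\ r\text{ even}} \mathrm I(Y:A_rC_r\,|\,X)_{\Psi_r},$$ where $\mathrm I(A:B)_\rho=S(\rho_A)+S(\rho_B)-S(\rho_{AB})$, $\mathrm I(A:B|C)_\rho=\mathrm I(A:BC)_\rho-\mathrm I(A:C)_\rho$ and $S(\rho)=-\mathrm{Tr}(\rho\log\rho)$. **Lemma.** Let $k\ge 1$, let $\mathrm{EQ}:\{0,1\}^k\times\{0,1\}^k\to\{0,1\}$ be the Equality function ($\mathrm{EQ}(x,y)=1$ if and only if $x=y$), and let $\mu$ be the uniform distribution on $1+1$ bits, so that $\mu^{\otimes k}$ is the uniform distribution on $k+k$ bits. Then every $t$-round quantum protocol $\Pi$ with shared entanglement whose worst-case error for $\mathrm{EQ}$ is at most $\tfrac13$ satisfies $$\mathrm{HQIC}(\Pi,\mu^{\otimes k})\ \ge\ \frac{1}{40000\,t}.$$ -/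

import Mathlib

/-!
# Entanglement-assisted two-party quantum protocols and Holevo information cost

Registers are finite-dimensional with a fixed orthonormal basis: a register of dimension `n` is
indexed by `Fin n`, a classical input register by the set of inputs.  A vector of a (joint)
register is its coordinate function and an operator is its matrix.
-/

noncomputable section

open scoped ComplexOrder

namespace QComm

/-! ### Entropy and mutual information (in bits) -/

/-- Von Neumann entropy `- Tr (ρ log₂ ρ)`; the functional calculus uses `Real.logb 2 0 = 0`, which
gives the usual convention `0 log 0 = 0`. -/
def entropy {K : Type*} [Fintype K] [DecidableEq K] (ρ : Matrix K K ℂ) : ℝ :=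
  -(Matrix.trace (ρ * cfc (Real.logb 2) ρ)).re

/-- The marginal `ρ_A` of `ρ_{AB}`. -/
def marginalFst {A B : Type*} [Fintype B] (ρ : Matrix (A × B) (A × B) ℂ) : Matrix A A ℂ :=
  fun a a' => ∑ b, ρ (a, b) (a', b)

/-- The marginal `ρ_B` of `ρ_{AB}`. -/
def marginalSnd {A B : Type*} [Fintype A] (ρ : Matrix (A × B) (A × B) ℂ) : Matrix B B ℂ :=
  fun b b' => ∑ a, ρ (a, b) (a, b')

/-- The marginal `ρ_{AC}` of `ρ_{ABC}`. -/
def marginalFstThd {A B C : Type*} [Fintype B] (ρ : Matrix (A × B × C) (A × B × C) ℂ) :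
    Matrix (A × C) (A × C) ℂ :=
  fun p q => ∑ b, ρ (p.1, b, p.2) (q.1, b, q.2)

/-- Mutual information `I(A : B) = S(A) + S(B) - S(AB)`. -/
def mutualInfo {A B : Type*} [Fintype A] [DecidableEq A] [Fintype B] [DecidableEq B]
    (ρ : Matrix (A × B) (A × B) ℂ) : ℝ :=
  entropy (marginalFst ρ) + entropy (marginalSnd ρ) - entropy ρ

/-- Conditional mutual information `I(A : B | C) = I(A : BC) - I(A : C)` of a state `ρ_{ABC}`. -/
def condMutualInfo {A B C : Type*} [Fintype A] [DecidableEq A] [Fintype B] [DecidableEq B]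
    [Fintype C] [DecidableEq C] (ρ : Matrix (A × B × C) (A × B × C) ℂ) : ℝ :=
  mutualInfo ρ - mutualInfo (marginalFstThd ρ)

/-! ### Protocols -/

/-- A unitary operator from a register indexed by `K` to a register indexed by `L`. -/
def IsUnitaryMap {K L : Type*} [Fintype K] [DecidableEq K] [Fintype L] [DecidableEq L]
    (U : Matrix L K ℂ) : Prop :=
  U.conjTranspose * U = 1 ∧ U * U.conjTranspose = 1

/-- A quantum protocol with shared entanglement and `t` messages, `t` even, on classical inputs
`x : X` (Alice) and `y : Y` (Bob). Alice sends the messages with odd number, Bob those with even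
number, and Alice gives the output.

For `j < t / 2`, round `2j+1` is Alice's unitary `U j x` and round `2j+2` is Bob's unitary `V j y`.
The registers `(A, C, B)` of Alice, of the message and of Bob have the dimensions
* `(dimA 0, 1, dimB 0)` at the start (there is no message yet, hence `dimC 0 = 1`),
* `(dimA (j+1), dimD j, dimB j)` at round `2j+1` (Bob's register is unchanged),
* `(dimA (j+1), dimC (j+1), dimB (j+1))` at round `2j+2` (Alice's register is unchanged).
The values of the fields at rounds after the `t`-th are irrelevant. -/
structure Protocol (X Y : Type*) (t : ℕ) where
  even_rounds : Even t
  dimA : ℕ → ℕ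
  dimB : ℕ → ℕ
  dimC : ℕ → ℕ
  dimD : ℕ → ℕ
  dimC_zero : dimC 0 = 1
  /-- The shared entangled pure state. -/
  shared : Fin (dimA 0) × Fin (dimB 0) → ℂ
  shared_unit : ∑ i, ‖shared i‖ ^ 2 = 1
  U : ∀ j, X → Matrix (Fin (dimA (j + 1)) × Fin (dimD j)) (Fin (dimA j) × Fin (dimC j)) ℂ
  U_unitary : ∀ j < t / 2, ∀ x, IsUnitaryMap (U j x)
  V : ∀ j, Y → Matrix (Fin (dimC (j + 1)) × Fin (dimB (j + 1))) (Fin (dimD j) × Fin (dimB j)) ℂ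
  V_unitary : ∀ j < t / 2, ∀ y, IsUnitaryMap (V j y)
  /-- Alice's final measurement `{M x, 1 - M x}` on her qubits (her register and the last message),
  which she may choose according to her input; `M x` corresponds to output `1`. -/
  M : X → Matrix (Fin (dimA (t / 2)) × Fin (dimC (t / 2)))
    (Fin (dimA (t / 2)) × Fin (dimC (t / 2))) ℂ
  M_nonneg : ∀ x, (M x).PosSemidef
  M_le_one : ∀ x, (1 - M x).PosSemidef

namespace Protocol

variable {X Y : Type*} {t : ℕ}

/-- Alice applies an operator `AC → A'C'` to a vector of `ACB`. -/
def applyAlice {A C B A' C' : Type*} [Fintype A] [Fintype C]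
    (U : Matrix (A' × C') (A × C) ℂ) (ψ : A × C × B → ℂ) : A' × C' × B → ℂ :=
  fun g => ∑ p : A × C, U (g.1, g.2.1) p * ψ (p.1, p.2, g.2.2)

/-- Bob applies an operator `CB → C'B'` to a vector of `ACB`. -/
def applyBob {A C B C' B' : Type*} [Fintype C] [Fintype B]
    (V : Matrix (C' × B') (C × B) ℂ) (ψ : A × C × B → ℂ) : A × C' × B' → ℂ :=
  fun g => ∑ p : C × B, V g.2 p * ψ (g.1, p)

/-- The joint state `Θ_{2j}^{x,y}` of the registers `A C B` after `2j` rounds on input `(x, y)`. -/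
def evenState (P : Protocol X Y t) (x : X) (y : Y) :
    (j : ℕ) → Fin (P.dimA j) × Fin (P.dimC j) × Fin (P.dimB j) → ℂ
  | 0 => fun g => P.shared (g.1, g.2.2)
  | j + 1 => applyBob (P.V j y) (applyAlice (P.U j x) (evenState P x y j))

/-- The joint state `Θ_{2j+1}^{x,y}` of the registers `A C B` after `2j+1` rounds. -/
def oddState (P : Protocol X Y t) (j : ℕ) (x : X) (y : Y) :
    Fin (P.dimA (j + 1)) × Fin (P.dimD j) × Fin (P.dimB j) → ℂ :=
  applyAlice (P.U j x) (P.evenState x y j)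

/-! ### Error -/

/-- The state of Alice's qubits (her register and the last message) at the end, on input
`(x, y)`. -/
def finalState (P : Protocol X Y t) (x : X) (y : Y) :
    Matrix (Fin (P.dimA (t / 2)) × Fin (P.dimC (t / 2)))
      (Fin (P.dimA (t / 2)) × Fin (P.dimC (t / 2))) ℂ :=
  fun p q => ∑ b, P.evenState x y (t / 2) (p.1, p.2, b) *
    star (P.evenState x y (t / 2) (q.1, q.2, b))

/-- `Pr[O(x, y) = o]`. -/
def outputProb (P : Protocol X Y t) (x : X) (y : Y) (o : Bool) : ℝ :=
  (Matrix.trace (P.finalState x y * if o then P.M x else 1 - P.M x)).re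

/-- The worst-case error `max_{x,y} Pr[O(x, y) ≠ F(x, y)]` for the function `F`. -/
def err (P : Protocol X Y t) (F : X → Y → Bool) : ℝ :=
  ⨆ p : X × Y, P.outputProb p.1 p.2 (!F p.1 p.2)

/-! ### Holevo information cost -/

variable [Fintype X] [DecidableEq X] [Fintype Y] [DecidableEq Y]

/-- The global pure state `∑ √μ(x,y) |x x y y⟩ |Θ^{x,y}⟩` of the registers `X R_X Y R_Y A C B`. -/
def globalState {A C B : Type*} (μ : X → Y → ℝ) (Θ : X → Y → A × C × B → ℂ) :
    X × X × Y × Y × A × C × B → ℂ :=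
  fun g => if g.2.1 = g.1 ∧ g.2.2.2.1 = g.2.2.1 then
    (Real.sqrt (μ g.1 g.2.2.1) : ℂ) * Θ g.1 g.2.2.1 g.2.2.2.2 else 0

/-- The density matrix `|ψ⟩⟨ψ|`. -/
def pureDensity {K : Type*} (ψ : K → ℂ) : Matrix K K ℂ := Matrix.vecMulVec ψ (star ψ)

/-- The marginal on the registers `X`, `BC`, `Y` (in this order) of a state of
`X R_X Y R_Y A C B`. -/
def bobMarginal {A C B : Type*} [Fintype A]
    (ρ : Matrix (X × X × Y × Y × A × C × B) (X × X × Y × Y × A × C × B) ℂ) :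
    Matrix (X × (B × C) × Y) (X × (B × C) × Y) ℂ :=
  fun p q => ∑ rx, ∑ ry, ∑ a,
    ρ (p.1, rx, p.2.2, ry, a, p.2.1.2, p.2.1.1) (q.1, rx, q.2.2, ry, a, q.2.1.2, q.2.1.1)

/-- The marginal on the registers `Y`, `AC`, `X` (in this order) of a state of
`X R_X Y R_Y A C B`. -/
def aliceMarginal {A C B : Type*} [Fintype B]
    (ρ : Matrix (X × X × Y × Y × A × C × B) (X × X × Y × Y × A × C × B) ℂ) :
    Matrix (Y × (A × C) × X) (Y × (A × C) × X) ℂ :=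
  fun p q => ∑ rx, ∑ ry, ∑ b,
    ρ (p.2.2, rx, p.1, ry, p.2.1.1, p.2.1.2, b) (q.2.2, rx, q.1, ry, q.2.1.1, q.2.1.2, b)

/-- The cumulative Holevo information cost
`∑_{i odd} I(X : B_i C_i | Y) + ∑_{i even} I(Y : A_i C_i | X)` over the rounds `1 ≤ i ≤ t`, for
inputs distributed according to `μ`. -/
def HQIC (P : Protocol X Y t) (μ : X → Y → ℝ) : ℝ :=
  ∑ j ∈ Finset.range (t / 2),
      condMutualInfo (bobMarginal (pureDensity (globalState μ (P.oddState j)))) +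
    ∑ j ∈ Finset.range (t / 2),
      condMutualInfo (aliceMarginal
        (pureDensity (globalState μ (fun x y => P.evenState x y (j + 1)))))

end Protocol

/-! ### Equality under the uniform distribution -/

/-- The Equality function on `k`-bit strings. -/
def equality (k : ℕ) (x y : Fin k → Bool) : Bool := decide (x = y)

/-- The uniform distribution on `1 + 1` bits. -/
def uniformBits (_ _ : Bool) : ℝ := 1 / 4

/-- The product distribution `μ^{⊗k}` on `k + k` bits of a distribution `μ` on `1 + 1` bits. -/
def tensorPow (μ : Bool → Bool → ℝ) (k : ℕ) (x y : Fin k → Bool) : ℝ := ∏ i, μ (x i) (y i)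

end QComm

end

set_option linter.unusedSectionVars false

noncomputable section

open scoped ComplexOrder

namespace QComm

/-! ### Spectral calculus of Hermitian matrices -/

section Spectral

open Matrix

variable {I J K : Type*} [Fintype I] [DecidableEq I] [Fintype J] [DecidableEq J]
  [Fintype K] [DecidableEq K]

/-! Low Holevo cost means that each message state barely depends on the sender's input, and then
cut-and-paste makes the protocol confuse equal inputs with unequal ones.

Information to distance: under a uniform prior, each round's conditional information is an average
of relative entropies between a receiver's state and its mean over the sender's input. A sharpened
Klein inequality bounds each below by `‖√ρ - √σ‖²` in Hilbert–Schmidt norm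
(`hsNorm_sqrt_sub_sqrt_sq_le`, `sum_hsNorm_sq_le_condMutualInfo`).

Distance to local operators: by polar decomposition, as in Uhlmann's theorem, two pure states whose
marginals are close in this distance are related, up to that distance, by a contraction on the
purifying register (`exists_contraction_hsNorm_le`). Unitarity is never needed, only that norms do
not grow.

Cut-and-paste: on a rectangle `{u, v} × {p, w}`, local contractions approximately carry the state on
`(v, w)` to the other three corners. The errors add up over rounds and involve distances between
`(v, w)`, `(u, w)` and `(v, p)` only (`cut_and_paste`). With `p = u` and `u ≠ w`, the state on `(u,
u)` is close to the state on `(u, w)` acted on by Bob alone, so Alice's acceptance amplitudes nearly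
agree in one direction. Correctness forces a gap of `1/5` (`one_fifth_le`). As `v` is free,
averaging over `u, v, w` weights all input pairs evenly, so the small mass of the diagonal does no
harm. Cauchy–Schwarz then returns to squared distances and costs the factor `t`. -/

theorem continuousOn_spectrum (f : ℝ → ℝ) (A : Matrix I I ℂ) : ContinuousOn f (spectrum ℝ A) :=
  Matrix.finite_real_spectrum.continuousOn f

theorem spectrum_nonneg {A : Matrix I I ℂ} (hA : A.PosSemidef) {x : ℝ} (hx : x ∈ spectrum ℝ A) :
    0 ≤ x := by
  rw [hA.1.spectrum_real_eq_range_eigenvalues] at hx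
  obtain ⟨i, rfl⟩ := hx
  exact hA.eigenvalues_nonneg i

/-- A function on finitely many points is a polynomial. -/
theorem exists_polynomial_eqOn (s : Set ℝ) (hs : s.Finite) (f : ℝ → ℝ) :
    ∃ p : Polynomial ℝ, ∀ x ∈ s, p.eval x = f x := by
  classical
  refine ⟨Lagrange.interpolate hs.toFinset id f, fun x hx => ?_⟩
  exact Lagrange.eval_interpolate_at_node f (Set.injOn_id _) (hs.mem_toFinset.2 hx)

theorem cfc_eq_aeval {A : Matrix I I ℂ} (hA : A.IsHermitian) {f : ℝ → ℝ} {p : Polynomial ℝ}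
    (h : ∀ x ∈ spectrum ℝ A, p.eval x = f x) : cfc f A = Polynomial.aeval A p := by
  rw [← cfc_polynomial p A hA]
  exact cfc_congr fun x hx => (h x hx).symm

/-- The functional calculus commutes with direct sums. -/
theorem cfc_blockDiagonal {d : I → Matrix K K ℂ} (hd : ∀ i, (d i).IsHermitian) (f : ℝ → ℝ) :
    cfc f (blockDiagonal d) = blockDiagonal fun i => cfc f (d i) := by
  have hB : (blockDiagonal d).IsHermitian := by
    rw [IsHermitian, blockDiagonal_conjTranspose]
    exact congrArg _ (funext fun i => hd i)
  -- A single polynomial interpolates `f` on the spectra of the sum and of all blocks, which reduces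
  -- the claim to powers and linear combinations.
  obtain ⟨p, hp⟩ := exists_polynomial_eqOn (spectrum ℝ (blockDiagonal d) ∪ ⋃ i, spectrum ℝ (d i))
    (Matrix.finite_real_spectrum.union (Set.finite_iUnion fun i => Matrix.finite_real_spectrum)) f
  rw [cfc_eq_aeval hB fun x hx => hp x (Or.inl hx)]
  have : (fun i => cfc f (d i)) = fun i => Polynomial.aeval (d i) p := funext fun i =>
    cfc_eq_aeval (hd i) fun x hx => hp x (Or.inr (Set.mem_iUnion.2 ⟨i, hx⟩))
  rw [this]
  clear * -
  induction p using Polynomial.induction_on' with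
  | add p q hp hq =>
    simp only [map_add, hp, hq, ← blockDiagonal_add]
    rfl
  | monomial n a =>
    simp only [Polynomial.aeval_monomial, ← blockDiagonal_pow, Algebra.algebraMap_eq_smul_one,
      smul_mul_assoc, one_mul, ← blockDiagonal_smul]
    rfl

theorem cfc_reindex {A : Matrix I I ℂ} (hA : A.IsHermitian) (e : I ≃ J) (f : ℝ → ℝ) :
    cfc f (reindex e e A) = reindex e e (cfc f A) := by
  obtain ⟨p, hp⟩ := exists_polynomial_eqOn (spectrum ℝ A ∪ spectrum ℝ (reindex e e A))
    (Matrix.finite_real_spectrum.union Matrix.finite_real_spectrum) f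
  have hR : (reindex e e A).IsHermitian := hA.submatrix _
  rw [cfc_eq_aeval hR fun x hx => hp x (Or.inr hx), cfc_eq_aeval hA fun x hx => hp x (Or.inl hx)]
  exact Polynomial.aeval_algHom_apply (Matrix.reindexAlgEquiv ℝ ℂ e) A p

/-- The squared overlaps of the eigenbases of two Hermitian matrices. -/
def overlap {A B : Matrix I I ℂ} (hA : A.IsHermitian) (hB : B.IsHermitian) (i j : I) : ℝ :=
  ‖(star (hA.eigenvectorUnitary : Matrix I I ℂ) * (hB.eigenvectorUnitary : Matrix I I ℂ)) i j‖ ^ 2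

theorem overlap_nonneg {A B : Matrix I I ℂ} (hA : A.IsHermitian) (hB : B.IsHermitian) (i j : I) :
    0 ≤ overlap hA hB i j := sq_nonneg _

/-- Expanding in the two eigenbases reduces noncommutative trace inequalities to scalar ones with
nonnegative weights. Taking `f` or `g` constant `1` recovers single traces, so the unit row and
column sums of the overlaps need no separate proof. -/
theorem trace_cfc_mul_cfc {A B : Matrix I I ℂ} (hA : A.IsHermitian) (hB : B.IsHermitian)
    (f g : ℝ → ℝ) :
    (trace (cfc f A * cfc g B)).re =
      ∑ i, ∑ j, f (hA.eigenvalues i) * g (hB.eigenvalues j) * overlap hA hB i j := by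
  have key : trace (cfc f A * cfc g B) =
      ((∑ i, ∑ j, f (hA.eigenvalues i) * g (hB.eigenvalues j) * overlap hA hB i j : ℝ) : ℂ) := by
    rw [hA.cfc_eq, hB.cfc_eq, IsHermitian.cfc, IsHermitian.cfc, Unitary.conjStarAlgAut_apply,
      Unitary.conjStarAlgAut_apply]
    set U : Matrix I I ℂ := (hA.eigenvectorUnitary : Matrix I I ℂ) with hU
    set V : Matrix I I ℂ := (hB.eigenvectorUnitary : Matrix I I ℂ) with hV
    set Q := star U * V with hQ
    have hs : star V * U = star Q := by simp [hQ]
    set a : I → ℂ := RCLike.ofReal ∘ f ∘ hA.eigenvalues with ha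
    set b : I → ℂ := RCLike.ofReal ∘ g ∘ hB.eigenvalues with hb
    have : trace (U * diagonal a * star U * (V * diagonal b * star V)) =
        trace (diagonal a * Q * (diagonal b * star Q)) := by
      rw [← hs, hQ]
      simp only [Matrix.mul_assoc]
      rw [Matrix.trace_mul_comm]
      simp only [Matrix.mul_assoc]
    rw [this, trace]
    push_cast
    refine Finset.sum_congr rfl fun i _ => ?_
    rw [diag_apply, Matrix.mul_apply]
    refine Finset.sum_congr rfl fun j _ => ?_
    rw [diagonal_mul, diagonal_mul, star_apply, overlap, ← hU, ← hV, ← hQ]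
    have := Complex.mul_conj' (Q i j)
    simp only [ha, hb, Function.comp, Complex.coe_algebraMap, Complex.ofReal_pow]
    rw [← this]
    simp only [RCLike.star_def]
    ring
  rw [key, Complex.ofReal_re]

end Spectral

/-! ### The Euclidean norm of vectors and of matrices -/

/-- The Euclidean norm of a vector. -/
def vecNorm {K : Type*} [Fintype K] (ψ : K → ℂ) : ℝ :=
  ‖(WithLp.toLp 2 ψ : EuclideanSpace ℂ K)‖

section Norm

variable {I J K : Type*} [Fintype I] [Fintype J] [Fintype K]

theorem vecNorm_nonneg (ψ : K → ℂ) : 0 ≤ vecNorm ψ := norm_nonneg _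

theorem vecNorm_sq (ψ : K → ℂ) : vecNorm ψ ^ 2 = ∑ i, ‖ψ i‖ ^ 2 :=
  EuclideanSpace.norm_sq_eq _

theorem vecNorm_sub_le (ψ φ χ : K → ℂ) :
    vecNorm (ψ - χ) ≤ vecNorm (ψ - φ) + vecNorm (φ - χ) := by
  simp only [vecNorm, WithLp.toLp_sub]
  exact norm_sub_le_norm_sub_add_norm_sub _ _ _

theorem vecNorm_sub_comm (ψ φ : K → ℂ) : vecNorm (ψ - φ) = vecNorm (φ - ψ) := by
  simp only [vecNorm, WithLp.toLp_sub]
  exact norm_sub_rev _ _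

theorem vecNorm_le_add (ψ φ : K → ℂ) : vecNorm ψ ≤ vecNorm (ψ - φ) + vecNorm φ := by
  have := vecNorm_sub_le ψ φ 0
  simpa using this

theorem vecNorm_sub_self (ψ : K → ℂ) : vecNorm (ψ - ψ) = 0 := by
  simp [vecNorm]

theorem vecNorm_le_of_sq_le {K' : Type*} [Fintype K'] {ψ : K → ℂ} {φ : K' → ℂ}
    (h : ∑ i, ‖ψ i‖ ^ 2 ≤ ∑ i, ‖φ i‖ ^ 2) : vecNorm ψ ≤ vecNorm φ := by
  rw [← vecNorm_sq, ← vecNorm_sq] at h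
  exact (sq_le_sq₀ (vecNorm_nonneg _) (vecNorm_nonneg _)).1 h

/-- The Hilbert–Schmidt norm of a matrix. -/
def hsNorm (M : Matrix I J ℂ) : ℝ := vecNorm fun p : I × J => M p.1 p.2

theorem hsNorm_sub_le (A B C : Matrix I J ℂ) : hsNorm (A - C) ≤ hsNorm (A - B) + hsNorm (B - C) :=
  vecNorm_sub_le (fun p : I × J => A p.1 p.2) (fun p => B p.1 p.2) (fun p => C p.1 p.2)

theorem hsNorm_sub_comm (A B : Matrix I J ℂ) : hsNorm (A - B) = hsNorm (B - A) :=
  vecNorm_sub_comm (fun p : I × J => A p.1 p.2) (fun p => B p.1 p.2)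

theorem hsNorm_nonneg (A : Matrix I J ℂ) : 0 ≤ hsNorm A := vecNorm_nonneg _

theorem hsNorm_sq (M : Matrix I J ℂ) : hsNorm M ^ 2 = (Matrix.trace (M * M.conjTranspose)).re := by
  rw [hsNorm, vecNorm_sq, Fintype.sum_prod_type, Matrix.trace, Complex.re_sum]
  refine Finset.sum_congr rfl fun i _ => ?_
  rw [Matrix.diag_apply, Matrix.mul_apply, Complex.re_sum]
  refine Finset.sum_congr rfl fun j _ => ?_
  rw [Matrix.conjTranspose_apply, RCLike.star_def, Complex.mul_conj', ← Complex.ofReal_pow,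
    Complex.ofReal_re]

end Norm

section Entropy

open Matrix

variable {I J K : Type*} [Fintype I] [DecidableEq I] [Fintype J] [DecidableEq J]
  [Fintype K] [DecidableEq K]

theorem cfc_isHermitian (f : ℝ → ℝ) (A : Matrix I I ℂ) : (cfc f A).IsHermitian :=
  cfc_predicate f A

/-! ### Elementary properties of the entropy -/

theorem entropy_reindex {A : Matrix I I ℂ} (hA : A.IsHermitian) (e : I ≃ J) :
    entropy (reindex e e A) = entropy A := by
  rw [entropy, cfc_reindex hA, entropy, reindex_apply, reindex_apply, submatrix_mul_equiv]
  exact congrArg (fun z : ℂ => -z.re) (e.symm.sum_comp fun i => (A * cfc (Real.logb 2) A) i i)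

theorem entropy_blockDiagonal {d : I → Matrix K K ℂ} (hd : ∀ i, (d i).IsHermitian) :
    entropy (blockDiagonal d) = ∑ i, entropy (d i) := by
  rw [entropy, cfc_blockDiagonal hd, ← blockDiagonal_mul, trace_blockDiagonal, Complex.re_sum,
    ← Finset.sum_neg_distrib]
  rfl

theorem entropy_eq_trace_cfc {A : Matrix I I ℂ} (hA : A.IsHermitian) :
    entropy A = -(trace (cfc (fun x => x * Real.logb 2 x) A)).re := by
  rw [entropy, cfc_mul _ _ A (continuousOn_spectrum _ _) (continuousOn_spectrum _ _),
    cfc_id' ℝ A hA.isSelfAdjoint]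

theorem mul_logb_mul (c x : ℝ) :
    c * x * Real.logb 2 (c * x) = c * (x * Real.logb 2 x) + c * Real.logb 2 c * x := by
  rcases eq_or_ne c 0 with rfl | hc
  · simp
  rcases eq_or_ne x 0 with rfl | hx
  · simp
  rw [Real.logb_mul hc hx]
  ring

theorem entropy_smul {A : Matrix I I ℂ} (hA : A.IsHermitian) (c : ℝ) :
    entropy (c • A) = c * entropy A - c * Real.logb 2 c * (trace A).re := by
  have hcA : (c • A).IsHermitian := by
    rw [IsHermitian, conjTranspose_smul, hA, star_trivial]
  rw [entropy_eq_trace_cfc hcA, entropy_eq_trace_cfc hA,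
    ← cfc_comp_smul c _ A ((Matrix.finite_real_spectrum.image _).continuousOn _) hA.isSelfAdjoint]
  simp only [smul_eq_mul, mul_logb_mul]
  rw [cfc_add A _ _ (continuousOn_spectrum _ _) (continuousOn_spectrum _ _),
    cfc_const_mul _ _ A (continuousOn_spectrum _ _),
    cfc_const_mul_id _ A hA.isSelfAdjoint, trace_add, trace_smul, trace_smul, Complex.add_re,
    Complex.smul_re, Complex.smul_re, smul_eq_mul, smul_eq_mul]
  ring

/-! ### Relative entropy and the Hellinger distance -/

/-- This is `log z ≤ z - 1` at `z = √b / √a`, multiplied by `2a`. The term `a - b` disappears after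
summation when the traces agree. -/
theorem hellinger_le_mul_log_sub {a b : ℝ} (ha : 0 ≤ a) (hb : 0 ≤ b) (h : b = 0 → a = 0) :
    (√a - √b) ^ 2 + a - b ≤ a * (Real.log a - Real.log b) := by
  rcases ha.eq_or_lt with rfl | ha'
  · simp [Real.sq_sqrt hb]
  have hb' : 0 < b := lt_of_le_of_ne hb fun h0 => ha'.ne' (h h0.symm)
  have hsa := Real.sqrt_pos.2 ha'
  have hsb := Real.sqrt_pos.2 hb'
  have h1 := Real.log_le_sub_one_of_pos (div_pos hsb hsa)
  rw [Real.log_div hsb.ne' hsa.ne', Real.log_sqrt hb, Real.log_sqrt ha] at h1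
  have h2 : a * (√b / √a) = √a * √b := by
    nth_rewrite 1 [← Real.mul_self_sqrt ha]
    field_simp
  have h3 := mul_le_mul_of_nonneg_left h1 ha
  have h4 := Real.sq_sqrt ha
  have h5 := Real.sq_sqrt hb
  nlinarith

theorem trace_mul_cfc_nonneg {A : Matrix I I ℂ} (hA : A.PosSemidef) {B : Matrix I I ℂ}
    (hB : B.IsHermitian) {g : ℝ → ℝ} (hg : ∀ x, 0 ≤ g x) : 0 ≤ (trace (A * cfc g B)).re := by
  have h := trace_cfc_mul_cfc hA.1 hB (fun x => x) g
  rw [cfc_id' ℝ A hA.1.isSelfAdjoint] at h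
  rw [h]
  exact Finset.sum_nonneg fun i _ => Finset.sum_nonneg fun j _ =>
    mul_nonneg (mul_nonneg (hA.eigenvalues_nonneg i) (hg _)) (overlap_nonneg _ _ _ _)

/-- The indicator function of `{0}`: applied to a Hermitian matrix it gives the projection onto
the kernel. -/
def zeroIndicator (x : ℝ) : ℝ := if x = 0 then 1 else 0

/-- A strengthening of Klein's inequality: the relative entropy is at least the squared Hellinger
distance. -/
theorem hsNorm_sqrt_sub_sqrt_sq_le {A B : Matrix I I ℂ} (hA : A.PosSemidef) (hB : B.PosSemidef)
    (hsupp : (trace (A * cfc zeroIndicator B)).re = 0) (htr : (trace A).re = (trace B).re) :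
    hsNorm (cfc Real.sqrt A - cfc Real.sqrt B) ^ 2 ≤
      (trace (A * cfc (Real.logb 2) A)).re - (trace (A * cfc (Real.logb 2) B)).re := by
  set l := hA.1.eigenvalues with hl
  set m := hB.1.eigenvalues with hm
  set Q := overlap hA.1 hB.1 with hQ
  have hl0 : ∀ i, 0 ≤ l i := hA.eigenvalues_nonneg
  have hm0 : ∀ i, 0 ≤ m i := hB.eigenvalues_nonneg
  have hQ0 : ∀ i j, 0 ≤ Q i j := overlap_nonneg _ _
  have tAg : ∀ g : ℝ → ℝ, (trace (A * cfc g B)).re = ∑ i, ∑ j, l i * g (m j) * Q i j := by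
    intro g
    have := trace_cfc_mul_cfc hA.1 hB.1 (fun x => x) g
    rwa [cfc_id' ℝ A hA.1.isSelfAdjoint] at this
  have tf : ∀ f : ℝ → ℝ, (trace (cfc f A)).re = ∑ i, ∑ j, f (l i) * Q i j := by
    intro f
    have := trace_cfc_mul_cfc hA.1 hB.1 f (fun _ => 1)
    rw [cfc_const_one ℝ B hB.1.isSelfAdjoint, mul_one] at this
    simpa using this
  have tg : ∀ g : ℝ → ℝ, (trace (cfc g B)).re = ∑ i, ∑ j, g (m j) * Q i j := by
    intro g
    have := trace_cfc_mul_cfc hA.1 hB.1 (fun _ => 1) g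
    rw [cfc_const_one ℝ A hA.1.isSelfAdjoint, one_mul] at this
    simpa using this
  -- The support condition is a vanishing sum of nonnegative terms. Hence the scalar inequality has
  -- its hypothesis `b = 0 → a = 0` wherever the weight is nonzero.
  have hz : ∀ i j, m j = 0 → l i * Q i j = 0 := by
    intro i j hj
    rw [tAg] at hsupp
    have hnn : ∀ i j, 0 ≤ l i * zeroIndicator (m j) * Q i j := fun i j =>
      mul_nonneg (mul_nonneg (hl0 i) (by unfold zeroIndicator; split_ifs <;> norm_num)) (hQ0 i j)
    have h1 := (Finset.sum_eq_zero_iff_of_nonneg fun i _ =>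
      Finset.sum_nonneg fun j _ => hnn i j).1 hsupp i (Finset.mem_univ i)
    have h2 := (Finset.sum_eq_zero_iff_of_nonneg fun j _ => hnn i j).1 h1 j (Finset.mem_univ j)
    simpa [zeroIndicator, hj] using h2
  have sqA : cfc Real.sqrt A * cfc Real.sqrt A = A := by
    rw [← cfc_mul _ _ A (continuousOn_spectrum _ _) (continuousOn_spectrum _ _)]
    conv_rhs => rw [← cfc_id' ℝ A hA.1.isSelfAdjoint]
    exact cfc_congr fun x hx => Real.mul_self_sqrt (spectrum_nonneg hA hx)
  have sqB : cfc Real.sqrt B * cfc Real.sqrt B = B := by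
    rw [← cfc_mul _ _ B (continuousOn_spectrum _ _) (continuousOn_spectrum _ _)]
    conv_rhs => rw [← cfc_id' ℝ B hB.1.isSelfAdjoint]
    exact cfc_congr fun x hx => Real.mul_self_sqrt (spectrum_nonneg hB hx)
  have trA : (trace A).re = ∑ i, ∑ j, l i * Q i j := by
    have := tf (fun x => x)
    rwa [cfc_id' ℝ A hA.1.isSelfAdjoint] at this
  have trB : (trace B).re = ∑ i, ∑ j, m j * Q i j := by
    have := tg (fun x => x)
    rwa [cfc_id' ℝ B hB.1.isSelfAdjoint] at this
  have hhs : hsNorm (cfc Real.sqrt A - cfc Real.sqrt B) ^ 2 =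
      ∑ i, ∑ j, ((√(l i) - √(m j)) ^ 2 + l i - m j) * Q i j := by
    rw [hsNorm_sq, conjTranspose_sub, (cfc_isHermitian _ A).eq, (cfc_isHermitian _ B).eq,
      mul_sub, sub_mul, sub_mul, sqA, sqB, trace_sub, trace_sub, trace_sub,
      trace_mul_comm (cfc Real.sqrt B), Complex.sub_re, Complex.sub_re, Complex.sub_re,
      trace_cfc_mul_cfc hA.1 hB.1]
    have hsplit : ∑ i, ∑ j, ((√(l i) - √(m j)) ^ 2 + l i - m j) * Q i j =
        2 * (∑ i, ∑ j, l i * Q i j) - 2 * ∑ i, ∑ j, √(l i) * √(m j) * Q i j := by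
      simp only [Finset.mul_sum, ← Finset.sum_sub_distrib]
      refine Finset.sum_congr rfl fun i _ => Finset.sum_congr rfl fun j _ => ?_
      rw [sub_sq, Real.sq_sqrt (hl0 i), Real.sq_sqrt (hm0 j)]
      ring
    rw [hsplit, ← trA, ← htr]
    ring
  have hlog : (trace (A * cfc (Real.logb 2) A)).re - (trace (A * cfc (Real.logb 2) B)).re =
      (∑ i, ∑ j, l i * (Real.log (l i) - Real.log (m j)) * Q i j) / Real.log 2 := by
    have h1 : A * cfc (Real.logb 2) A = cfc (fun x => x * Real.logb 2 x) A := by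
      rw [cfc_mul _ _ A (continuousOn_spectrum _ _) (continuousOn_spectrum _ _), cfc_id' ℝ A hA.1.isSelfAdjoint]
    rw [h1, tf, tAg, ← Finset.sum_sub_distrib, Finset.sum_div]
    refine Finset.sum_congr rfl fun i _ => ?_
    rw [← Finset.sum_sub_distrib, Finset.sum_div]
    refine Finset.sum_congr rfl fun j _ => ?_
    simp only [Real.logb]
    ring
  have hle : hsNorm (cfc Real.sqrt A - cfc Real.sqrt B) ^ 2 ≤
      ∑ i, ∑ j, l i * (Real.log (l i) - Real.log (m j)) * Q i j := by
    rw [hhs]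
    refine Finset.sum_le_sum fun i _ => Finset.sum_le_sum fun j _ => ?_
    rcases (hQ0 i j).eq_or_lt with h0 | hpos
    · rw [← h0]; simp
    · refine mul_le_mul_of_nonneg_right (hellinger_le_mul_log_sub (hl0 i) (hm0 j) fun hj => ?_)
        hpos.le
      exact (mul_eq_zero.1 (hz i j hj)).resolve_right hpos.ne'
  rw [hlog, le_div_iff₀ (Real.log_pos one_lt_two)]
  -- Passing from nats to bits divides by `log 2 ≤ 1`, which only helps.
  have h2 : Real.log 2 ≤ 1 := by linarith [Real.log_two_lt_d9]
  nlinarith [sq_nonneg (hsNorm (cfc Real.sqrt A - cfc Real.sqrt B))]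

/-- The Holevo information of a uniform ensemble bounds the mean squared Hellinger distance of its
members from the average. -/
theorem sum_hsNorm_sq_le_holevo [Nonempty J] {ρ : J → Matrix I I ℂ} (hρ : ∀ x, (ρ x).PosSemidef)
    (htr : ∀ x, (trace (ρ x)).re = 1) {σ : Matrix I I ℂ}
    (hσ : σ = (Fintype.card J : ℝ)⁻¹ • ∑ x, ρ x) :
    ∑ x, hsNorm (cfc Real.sqrt (ρ x) - cfc Real.sqrt σ) ^ 2 ≤
      Fintype.card J * entropy σ - ∑ x, entropy (ρ x) := by
  have hn : (0 : ℝ) < Fintype.card J := Nat.cast_pos.2 Fintype.card_pos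
  have hsum : (Fintype.card J : ℝ) • σ = ∑ x, ρ x := by
    rw [hσ, smul_smul, mul_inv_cancel₀ hn.ne', one_smul]
  have hS : (∑ x, ρ x).PosSemidef := by
    refine Finset.sum_induction _ _ (fun _ _ => PosSemidef.add) PosSemidef.zero fun x _ => hρ x
  have hσp : σ.PosSemidef := by
    rw [hσ]
    exact hS.smul (inv_nonneg.2 hn.le)
  have hlin : ∀ Z : Matrix I I ℂ,
      Fintype.card J * (trace (σ * Z)).re = ∑ x, (trace (ρ x * Z)).re := by
    intro Z
    rw [← Complex.re_sum, ← trace_sum, ← Finset.sum_mul, ← hsum, smul_mul_assoc, trace_smul,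
      Complex.smul_re, smul_eq_mul]
  have htrσ : (trace σ).re = 1 := by
    have := hlin 1
    simp only [mul_one, htr, Finset.sum_const, Finset.card_univ, nsmul_eq_mul] at this
    exact mul_left_cancel₀ hn.ne' (by simpa using this)
  have hz : (trace (σ * cfc zeroIndicator σ)).re = 0 := by
    have : σ * cfc zeroIndicator σ = cfc (fun x => x * zeroIndicator x) σ := by
      rw [cfc_mul _ _ σ (continuousOn_spectrum _ _) (continuousOn_spectrum _ _),
        cfc_id' ℝ σ hσp.1.isSelfAdjoint]
    have h0 : (fun x => x * zeroIndicator x) = fun _ : ℝ => (0 : ℝ) := by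
      funext x
      by_cases h : x = 0 <;> simp [zeroIndicator, h]
    rw [this, h0, cfc_const_zero]
    simp
  -- The kernel projection of `σ` has zero trace against the sum of the positive `ρ x`, hence
  -- against each of them.
  have hzx : ∀ x, (trace (ρ x * cfc zeroIndicator σ)).re = 0 := by
    have h0 := hlin (cfc zeroIndicator σ)
    rw [hz, mul_zero] at h0
    intro x
    exact (Finset.sum_eq_zero_iff_of_nonneg fun x _ =>
      trace_mul_cfc_nonneg (hρ x) hσp.1 fun y => by
        unfold zeroIndicator; split_ifs <;> norm_num).1 h0.symm x (Finset.mem_univ x)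
  calc ∑ x, hsNorm (cfc Real.sqrt (ρ x) - cfc Real.sqrt σ) ^ 2
      ≤ ∑ x, ((trace (ρ x * cfc (Real.logb 2) (ρ x))).re
          - (trace (ρ x * cfc (Real.logb 2) σ)).re) :=
        Finset.sum_le_sum fun x _ =>
          hsNorm_sqrt_sub_sqrt_sq_le (hρ x) hσp (hzx x) ((htr x).trans htrσ.symm)
    _ = Fintype.card J * entropy σ - ∑ x, entropy (ρ x) := by
        rw [Finset.sum_sub_distrib, ← hlin]
        simp only [entropy, Finset.sum_neg_distrib]
        ring

end Entropy

/-! ### Conditional mutual information of classical-quantum states -/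

section ClassicalQuantum

open Matrix

variable {X Y K : Type*} [Fintype X] [DecidableEq X] [Fintype Y] [DecidableEq Y]
  [Fintype K] [DecidableEq K]

/-- The state `c ∑ |x⟩⟨x| ⊗ ρ x y ⊗ |y⟩⟨y|`. -/
def cqState (c : ℝ) (ρ : X → Y → Matrix K K ℂ) : Matrix (X × K × Y) (X × K × Y) ℂ :=
  fun p q => if p.1 = q.1 ∧ p.2.2 = q.2.2 then (c : ℂ) * ρ p.1 p.2.2 p.2.1 q.2.1 else 0

theorem isHermitian_real_smul {A : Matrix K K ℂ} (hA : A.IsHermitian) (c : ℝ) :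
    (c • A).IsHermitian := by
  rw [IsHermitian, conjTranspose_smul, hA, star_trivial]

theorem isHermitian_blockDiagonal {d : X → Matrix K K ℂ} (hd : ∀ i, (d i).IsHermitian) :
    (blockDiagonal d).IsHermitian := by
  rw [IsHermitian, blockDiagonal_conjTranspose]
  exact congrArg _ (funext fun i => hd i)

theorem entropy_one : entropy (1 : Matrix K K ℂ) = 0 := by
  rw [entropy_eq_trace_cfc isHermitian_one, cfc_apply_one]
  simp

theorem entropy_smul_one (c : ℝ) :
    entropy (c • (1 : Matrix K K ℂ)) = -(c * Real.logb 2 c * Fintype.card K) := by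
  rw [entropy_smul isHermitian_one, entropy_one, trace_one]
  simp

theorem marginalFst_marginalFstThd {A B C : Type*} [Fintype B] [Fintype C]
    (ρ : Matrix (A × B × C) (A × B × C) ℂ) :
    marginalFst (marginalFstThd ρ) = marginalFst ρ := by
  ext a a'
  simp only [marginalFst, marginalFstThd, Fintype.sum_prod_type]
  exact Finset.sum_comm

theorem entropy_cqState {ρ : X → Y → Matrix K K ℂ} (hρ : ∀ x y, (ρ x y).IsHermitian)
    (htr : ∀ x y, trace (ρ x y) = 1) (c : ℝ) :
    entropy (cqState c ρ) = c * ∑ x, ∑ y, entropy (ρ x y) -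
      c * Real.logb 2 c * (Fintype.card X * Fintype.card Y) := by
  -- Collecting the two classical labels into one block index exhibits the state as a direct sum.
  let e : K × (X × Y) ≃ X × K × Y :=
    { toFun := fun p => (p.2.1, p.1, p.2.2)
      invFun := fun p => (p.2.1, (p.1, p.2.2))
      left_inv := fun _ => rfl
      right_inv := fun _ => rfl }
  have hB := isHermitian_blockDiagonal (d := fun z : X × Y => ρ z.1 z.2) fun z => hρ z.1 z.2
  have h : cqState c ρ = reindex e e (c • blockDiagonal fun z : X × Y => ρ z.1 z.2) := by
    ext p q
    obtain ⟨x, k, y⟩ := p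
    obtain ⟨x', k', y'⟩ := q
    simp [cqState, e, blockDiagonal_apply, Prod.ext_iff]
  rw [h, entropy_reindex (isHermitian_real_smul hB c), entropy_smul hB,
    entropy_blockDiagonal fun z : X × Y => hρ z.1 z.2, trace_blockDiagonal, Fintype.sum_prod_type]
  simp [htr]

theorem marginalSnd_cqState {ρ : X → Y → Matrix K K ℂ} {σ : Y → Matrix K K ℂ}
    (hσ : ∀ y, (Fintype.card X : ℝ) • σ y = ∑ x, ρ x y) (c : ℝ) :
    marginalSnd (cqState c ρ) = (c * Fintype.card X) • blockDiagonal σ := by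
  ext p q
  obtain ⟨k, y⟩ := p
  obtain ⟨k', y'⟩ := q
  rcases eq_or_ne y y' with rfl | hy
  · have := congrFun (congrFun (hσ y) k) k'
    rw [Matrix.sum_apply] at this
    simp only [marginalSnd, cqState, and_self, if_true, Matrix.smul_apply, blockDiagonal_apply_eq,
      ← Finset.mul_sum, ← this, mul_smul, Complex.real_smul]
  · simp [marginalSnd, cqState, blockDiagonal_apply, hy]

theorem marginalFstThd_cqState {ρ : X → Y → Matrix K K ℂ} (htr : ∀ x y, trace (ρ x y) = 1)
    (c : ℝ) : marginalFstThd (cqState c ρ) = c • (1 : Matrix (X × Y) (X × Y) ℂ) := by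
  ext p q
  obtain ⟨x, y⟩ := p
  obtain ⟨x', y'⟩ := q
  by_cases h : x = x' ∧ y = y'
  · obtain ⟨rfl, rfl⟩ := h
    simp only [marginalFstThd, cqState, and_self, if_true, Matrix.smul_apply, one_apply_eq,
      ← Finset.mul_sum, Complex.real_smul]
    exact congrArg _ (htr x y)
  · simp [marginalFstThd, cqState, one_apply, Prod.ext_iff, h]

theorem marginalSnd_smul_one (c : ℝ) :
    marginalSnd (c • (1 : Matrix (X × Y) (X × Y) ℂ)) =
      (c * Fintype.card X) • (1 : Matrix Y Y ℂ) := by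
  ext y y'
  rcases eq_or_ne y y' with rfl | hy
  · simp [marginalSnd, mul_comm]
  · simp [marginalSnd, one_apply, hy]

/-- The average over `x` of the members of an ensemble. -/
def ensembleMean (ρ : X → Y → Matrix K K ℂ) (y : Y) : Matrix K K ℂ :=
  (Fintype.card X : ℝ)⁻¹ • ∑ x, ρ x y

/-- The information about `X` given `Y` in a uniform ensemble bounds the mean squared Hellinger
distance from the average over `X`. -/
theorem sum_hsNorm_sq_le_condMutualInfo [Nonempty X] {ρ : X → Y → Matrix K K ℂ}
    (hρ : ∀ x y, (ρ x y).PosSemidef) (htr : ∀ x y, trace (ρ x y) = 1) {c : ℝ} (hc : 0 ≤ c) :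
    c * ∑ x, ∑ y, hsNorm (cfc Real.sqrt (ρ x y) - cfc Real.sqrt (ensembleMean ρ y)) ^ 2 ≤
      condMutualInfo (cqState c ρ) := by
  have hn : (Fintype.card X : ℝ) ≠ 0 := Nat.cast_ne_zero.2 Fintype.card_ne_zero
  have hσ : ∀ y, (Fintype.card X : ℝ) • ensembleMean ρ y = ∑ x, ρ x y := fun y => by
    rw [ensembleMean, smul_smul, mul_inv_cancel₀ hn, one_smul]
  have hσH : ∀ y, (ensembleMean ρ y).IsHermitian := fun y =>
    isHermitian_real_smul (by
      rw [IsHermitian, conjTranspose_sum]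
      exact Finset.sum_congr rfl fun x _ => (hρ x y).1) _
  have hσtr : ∀ y, trace (ensembleMean ρ y) = 1 := fun y => by
    rw [ensembleMean, trace_smul, trace_sum]
    simp [htr]
  -- The entropy of `X` occurs in both mutual informations, and the logarithms of the weights cancel
  -- between the remaining entropies; `c` need not be normalized.
  have hI : condMutualInfo (cqState c ρ) =
      c * ∑ y, (Fintype.card X * entropy (ensembleMean ρ y) - ∑ x, entropy (ρ x y)) := by
    rw [condMutualInfo, mutualInfo, mutualInfo, marginalFst_marginalFstThd,
      marginalFstThd_cqState htr, marginalSnd_smul_one, entropy_smul_one, entropy_smul_one,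
      entropy_cqState (fun x y => (hρ x y).1) htr, marginalSnd_cqState hσ,
      entropy_smul (isHermitian_blockDiagonal hσH), entropy_blockDiagonal hσH,
      trace_blockDiagonal, Finset.sum_sub_distrib, ← Finset.mul_sum, Fintype.card_prod,
      Finset.sum_comm (s := (Finset.univ : Finset Y))]
    simp only [hσtr, Finset.sum_const, Finset.card_univ, nsmul_eq_mul, mul_one, Complex.natCast_re,
      Nat.cast_mul]
    ring
  rw [hI, Finset.sum_comm]
  refine mul_le_mul_of_nonneg_left (Finset.sum_le_sum fun y _ => ?_) hc
  exact sum_hsNorm_sq_le_holevo (fun x => hρ x y) (fun x => by rw [htr]; rfl) rfl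

end ClassicalQuantum

/-! ### Contractions -/

section Contraction

open Matrix

variable {I J K L : Type*} [Fintype I] [Fintype J] [Fintype K] [Fintype L]

/-- `M` does not increase the Euclidean norm. -/
def IsContraction (M : Matrix I J ℂ) : Prop := ∀ v : J → ℂ, vecNorm (M *ᵥ v) ≤ vecNorm v

theorem IsContraction.sum_sq_le {M : Matrix I J ℂ} (hM : IsContraction M) (v : J → ℂ) :
    ∑ i, ‖(M *ᵥ v) i‖ ^ 2 ≤ ∑ j, ‖v j‖ ^ 2 := by
  rw [← vecNorm_sq, ← vecNorm_sq]
  exact pow_le_pow_left₀ (vecNorm_nonneg _) (hM v) 2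

theorem isContraction_one [DecidableEq I] : IsContraction (1 : Matrix I I ℂ) := fun v => by
  rw [one_mulVec]

theorem IsContraction.mul {M : Matrix I J ℂ} {N : Matrix J K ℂ} (hM : IsContraction M)
    (hN : IsContraction N) : IsContraction (M * N) := fun v => by
  rw [← mulVec_mulVec]
  exact (hM _).trans (hN v)

theorem vecNorm_star (v : I → ℂ) : vecNorm (star v) = vecNorm v := by
  apply le_antisymm <;> apply vecNorm_le_of_sq_le <;> simp

theorem IsContraction.map_star {M : Matrix I J ℂ} (hM : IsContraction M) :
    IsContraction (M.map star) := fun v => by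
  have h : M.map star *ᵥ v = star (M *ᵥ star v) := by
    ext i
    simp [mulVec, dotProduct]
  rw [h, vecNorm_star, ← vecNorm_star v]
  exact hM _

open scoped Matrix.Norms.L2Operator in
theorem isContraction_iff_norm_le [DecidableEq J] {M : Matrix I J ℂ} :
    IsContraction M ↔ ‖M‖ ≤ 1 := by
  constructor
  · intro h
    rw [l2_opNorm_def]
    refine ContinuousLinearMap.opNorm_le_bound _ zero_le_one fun v => ?_
    rw [one_mul]
    exact h v.ofLp
  · intro h v
    exact (l2_opNorm_mulVec M (WithLp.toLp 2 v)).trans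
      (mul_le_of_le_one_left (norm_nonneg _) h)

theorem IsContraction.conjTranspose [DecidableEq I] [DecidableEq J] {M : Matrix I J ℂ}
    (hM : IsContraction M) : IsContraction Mᴴ := by
  rw [isContraction_iff_norm_le] at hM ⊢
  rwa [l2_opNorm_conjTranspose]

theorem IsContraction.transpose [DecidableEq I] [DecidableEq J] {M : Matrix I J ℂ}
    (hM : IsContraction M) : IsContraction Mᵀ := by
  have h := hM.map_star.conjTranspose
  have h' : (M.map star)ᴴ = Mᵀ := by
    ext i j
    simp
  rwa [h'] at h

theorem star_dotProduct_self_re (v : I → ℂ) : (star v ⬝ᵥ v).re = ∑ i, ‖v i‖ ^ 2 := by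
  rw [dotProduct, Complex.re_sum]
  refine Finset.sum_congr rfl fun i _ => ?_
  rw [Pi.star_apply, RCLike.star_def, Complex.conj_mul', ← Complex.ofReal_pow, Complex.ofReal_re]

theorem sum_sq_mulVec (M : Matrix I J ℂ) (v : J → ℂ) :
    ∑ i, ‖(M *ᵥ v) i‖ ^ 2 = (star v ⬝ᵥ ((Mᴴ * M) *ᵥ v)).re := by
  rw [← star_dotProduct_self_re, star_mulVec, ← dotProduct_mulVec, mulVec_mulVec]

theorem sum_sq_mulVec_of_isometry [DecidableEq J] {M : Matrix I J ℂ} (hM : Mᴴ * M = 1)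
    (v : J → ℂ) : ∑ i, ‖(M *ᵥ v) i‖ ^ 2 = ∑ i, ‖v i‖ ^ 2 := by
  rw [sum_sq_mulVec, hM, one_mulVec, star_dotProduct_self_re]

theorem isContraction_of_isometry [DecidableEq J] {M : Matrix I J ℂ} (hM : Mᴴ * M = 1) :
    IsContraction M := fun v => vecNorm_le_of_sq_le (sum_sq_mulVec_of_isometry hM v).le

theorem isContraction_of_conjTranspose_mul_self_le [DecidableEq J] {M : Matrix I J ℂ}
    (hM : (1 - Mᴴ * M).PosSemidef) : IsContraction M := fun v => by
  refine vecNorm_le_of_sq_le ?_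
  have h := hM.re_dotProduct_nonneg v
  rw [sub_mulVec, one_mulVec, dotProduct_sub, map_sub] at h
  rw [sum_sq_mulVec, ← star_dotProduct_self_re]
  exact sub_nonneg.1 h

open scoped Matrix.Norms.L2Operator in
-- By the C*-identity, `n = ‖W * Wᴴ‖ = ‖W‖²` satisfies `n = n²`, which excludes `‖W‖ > 1`.
theorem isContraction_of_mul_conjTranspose_idempotent [DecidableEq I] [DecidableEq J]
    {W : Matrix I J ℂ} (hW : (W * Wᴴ) * (W * Wᴴ) = W * Wᴴ) : IsContraction W := by
  rw [isContraction_iff_norm_le]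
  have h1 : ‖W * Wᴴ‖ = ‖W‖ * ‖W‖ := by
    have := l2_opNorm_conjTranspose_mul_self Wᴴ
    rwa [conjTranspose_conjTranspose, l2_opNorm_conjTranspose] at this
  have h2 : ‖W * Wᴴ‖ = ‖W * Wᴴ‖ * ‖W * Wᴴ‖ := by
    have := l2_opNorm_conjTranspose_mul_self (W * Wᴴ)
    rwa [conjTranspose_mul, conjTranspose_conjTranspose, hW] at this
  by_contra! hlt
  have h3 : 1 < ‖W‖ * ‖W‖ := by nlinarith
  rw [← h1] at h3
  nlinarith

theorem hsNorm_mul_le [DecidableEq K] [DecidableEq J] {W : Matrix J K ℂ} (hW : IsContraction W)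
    (A : Matrix I J ℂ) : hsNorm (A * W) ≤ hsNorm A := by
  refine vecNorm_le_of_sq_le ?_
  rw [Fintype.sum_prod_type, Fintype.sum_prod_type]
  refine Finset.sum_le_sum fun i _ => ?_
  have h := hW.transpose.sum_sq_le (A i)
  have h' : Wᵀ *ᵥ A i = (A * W) i := by
    ext k
    rw [mulVec_transpose]
    rfl
  rwa [h'] at h

/-- Polar decomposition, with a partial isometry on the right. -/
theorem exists_polar [DecidableEq K] [DecidableEq L] (N : Matrix L K ℂ) :
    ∃ W : Matrix L K ℂ, IsContraction W ∧ cfc Real.sqrt (N * Nᴴ) * W = N ∧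
      N * Wᴴ = cfc Real.sqrt (N * Nᴴ) := by
  set ρ := N * Nᴴ with hρdef
  have hρ : ρ.PosSemidef := posSemidef_self_mul_conjTranspose N
  -- Since `0⁻¹ = 0`, `T` is the pseudo-inverse of `√ρ` and `P` below is the support projection of
  -- `ρ`. The partial isometry will be `T * N`.
  set T := cfc (fun x => (√x)⁻¹) ρ with hTdef
  set P := cfc (fun x => √x * (√x)⁻¹) ρ with hPdef
  have hTH : Tᴴ = T := cfc_isHermitian _ ρ
  have hPH : Pᴴ = P := cfc_isHermitian _ ρ
  have hmul : ∀ f g : ℝ → ℝ, cfc f ρ * cfc g ρ = cfc (fun x => f x * g x) ρ := fun f g =>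
    (cfc_mul f g ρ (continuousOn_spectrum _ _) (continuousOn_spectrum _ _)).symm
  have hid : cfc (fun x : ℝ => x) ρ = ρ := cfc_id' ℝ ρ hρ.1.isSelfAdjoint
  have hST : cfc Real.sqrt ρ * T = P := hmul _ _
  have hρT : ρ * T = cfc Real.sqrt ρ := by
    nth_rewrite 1 [← hid]
    rw [hTdef, hmul]
    refine cfc_congr fun x hx => ?_
    have h0 := spectrum_nonneg hρ hx
    rcases h0.eq_or_lt with rfl | h0
    · simp
    · have := (Real.sqrt_pos.2 h0).ne'
      field_simp
      exact (Real.sq_sqrt h0.le).symm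
  have hPP : P * P = P := by
    rw [hPdef, hmul]
    refine cfc_congr fun x _ => ?_
    by_cases h : √x = 0 <;> simp [h]
  have hTS : T * cfc Real.sqrt ρ = P := by
    rw [hTdef, hmul, hPdef]
    simp only [mul_comm]
  have hPρ : P * ρ = ρ := by
    nth_rewrite 1 [← hid]
    conv_rhs => rw [← hid]
    rw [hPdef, hmul]
    refine cfc_congr fun x hx => ?_
    rcases (spectrum_nonneg hρ hx).eq_or_lt with rfl | h0
    · simp
    · simp [(Real.sqrt_pos.2 h0).ne']
  have hPN : P * N = N := by
    have h0 : (N - P * N) * (N - P * N)ᴴ = 0 := by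
      have hρP : ρ * P = ρ := by
        have := congrArg Matrix.conjTranspose hPρ
        rwa [conjTranspose_mul, hPH, hρ.1.eq] at this
      rw [conjTranspose_sub, conjTranspose_mul, hPH, Matrix.mul_sub, Matrix.sub_mul,
        Matrix.sub_mul, Matrix.mul_assoc P N Nᴴ, ← Matrix.mul_assoc N Nᴴ P,
        Matrix.mul_assoc P N, ← Matrix.mul_assoc N Nᴴ P, ← hρdef, hρP, hPρ]
      simp
    have h1 := self_mul_conjTranspose_eq_zero.1 h0
    exact (sub_eq_zero.1 h1).symm
  refine ⟨T * N, isContraction_of_mul_conjTranspose_idempotent ?_, ?_, ?_⟩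
  · have hW : T * N * (T * N)ᴴ = P := by
      rw [conjTranspose_mul, hTH, Matrix.mul_assoc, ← Matrix.mul_assoc N, ← hρdef, hρT, hTS]
    rw [hW, hPP]
  · rw [← Matrix.mul_assoc, hST, hPN]
  · rw [conjTranspose_mul, hTH, ← Matrix.mul_assoc, ← hρdef, hρT]

/-- Two purifications are related by a contraction up to the Hellinger distance of their
marginals. -/
theorem exists_contraction_hsNorm_le [DecidableEq K] [DecidableEq L] (N N' : Matrix L K ℂ) :
    ∃ D : Matrix K K ℂ, IsContraction D ∧ hsNorm (N * Dᵀ - N') ≤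
      hsNorm (cfc Real.sqrt (N * Nᴴ) - cfc Real.sqrt (N' * N'ᴴ)) := by
  obtain ⟨W, hW, -, hNW⟩ := exists_polar N
  obtain ⟨W', hW', hSW', -⟩ := exists_polar N'
  -- Undo the polar part of `N` and apply that of `N'`: `N * Wᴴ * W' = √(N Nᴴ) * W'`, to be compared
  -- with `N' = √(N' N'ᴴ) * W'`.
  refine ⟨(Wᴴ * W')ᵀ, (hW.conjTranspose.mul hW').transpose, ?_⟩
  have h : N * (Wᴴ * W')ᵀᵀ - N' =
      (cfc Real.sqrt (N * Nᴴ) - cfc Real.sqrt (N' * N'ᴴ)) * W' := by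
    rw [transpose_transpose, ← Matrix.mul_assoc, hNW, Matrix.sub_mul, hSW']
  rw [h]
  exact hsNorm_mul_le hW' _

end Contraction

/-! ### Local operators -/

namespace Protocol

section Local

open Matrix

variable {A B C A' B' C' : Type*} [Fintype A] [Fintype B] [Fintype C]
  [Fintype A'] [Fintype B'] [Fintype C']

/-- An operator acting on the register `A` of `ACB`. -/
def actFst (D : Matrix A A ℂ) (ψ : A × C × B → ℂ) : A × C × B → ℂ :=
  fun g => ∑ a, D g.1 a * ψ (a, g.2)

/-- An operator acting on the register `B` of `ACB`. -/
def actThd (E : Matrix B B ℂ) (ψ : A × C × B → ℂ) : A × C × B → ℂ :=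
  fun g => ∑ b, E g.2.2 b * ψ (g.1, g.2.1, b)

theorem actFst_sub (D : Matrix A A ℂ) (ψ φ : A × C × B → ℂ) :
    actFst D (ψ - φ) = actFst D ψ - actFst D φ := by
  ext g
  simp [actFst, mul_sub]

theorem actThd_sub (E : Matrix B B ℂ) (ψ φ : A × C × B → ℂ) :
    actThd E (ψ - φ) = actThd E ψ - actThd E φ := by
  ext g
  simp [actThd, mul_sub]

theorem applyAlice_sub (U : Matrix (A' × C') (A × C) ℂ) (ψ φ : A × C × B → ℂ) :
    applyAlice U (ψ - φ) = applyAlice U ψ - applyAlice U φ := by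
  ext g
  simp [applyAlice, mul_sub]

theorem applyBob_sub (V : Matrix (C' × B') (C × B) ℂ) (ψ φ : A × C × B → ℂ) :
    applyBob V (ψ - φ) = applyBob V ψ - applyBob V φ := by
  ext g
  simp [applyBob, mul_sub]

theorem actFst_one [DecidableEq A] (ψ : A × C × B → ℂ) : actFst 1 ψ = ψ := by
  ext g
  simp [actFst, one_apply]

theorem actThd_one [DecidableEq B] (ψ : A × C × B → ℂ) : actThd 1 ψ = ψ := by
  ext g
  simp [actThd, one_apply]

theorem actThd_applyAlice (E : Matrix B B ℂ) (U : Matrix (A' × C') (A × C) ℂ)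
    (ψ : A × C × B → ℂ) : actThd E (applyAlice U ψ) = applyAlice U (actThd E ψ) := by
  ext g
  simp only [actThd, applyAlice, Finset.mul_sum]
  rw [Finset.sum_comm]
  exact Finset.sum_congr rfl fun _ _ => Finset.sum_congr rfl fun _ _ => mul_left_comm _ _ _

theorem actFst_applyBob (D : Matrix A A ℂ) (V : Matrix (C' × B') (C × B) ℂ)
    (ψ : A × C × B → ℂ) : actFst D (applyBob V ψ) = applyBob V (actFst D ψ) := by
  ext g
  simp only [actFst, applyBob, Finset.mul_sum]
  rw [Finset.sum_comm]
  exact Finset.sum_congr rfl fun _ _ => Finset.sum_congr rfl fun _ _ => mul_left_comm _ _ _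

theorem actFst_actThd (D : Matrix A A ℂ) (E : Matrix B B ℂ) (ψ : A × C × B → ℂ) :
    actFst D (actThd E ψ) = actThd E (actFst D ψ) := by
  ext g
  simp only [actFst, actThd, Finset.mul_sum]
  rw [Finset.sum_comm]
  exact Finset.sum_congr rfl fun _ _ => Finset.sum_congr rfl fun _ _ => mul_left_comm _ _ _

theorem sum_rotate {M : Type*} [AddCommMonoid M] (f : A × C × B → M) :
    ∑ g, f g = ∑ b, ∑ p : A × C, f (p.1, p.2, b) := by
  rw [Finset.sum_comm]
  simp only [Fintype.sum_prod_type]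

theorem sum_swap {M : Type*} [AddCommMonoid M] (f : A × C × B → M) :
    ∑ g, f g = ∑ q : C × B, ∑ a, f (a, q) := by
  rw [Fintype.sum_prod_type, Finset.sum_comm]

theorem vecNorm_applyAlice_le {U : Matrix (A' × C') (A × C) ℂ} (hU : IsContraction U)
    (ψ : A × C × B → ℂ) : vecNorm (applyAlice U ψ) ≤ vecNorm ψ := by
  refine vecNorm_le_of_sq_le ?_
  rw [sum_rotate, sum_rotate]
  exact Finset.sum_le_sum fun b _ => hU.sum_sq_le fun p => ψ (p.1, p.2, b)

theorem vecNorm_applyBob_le {V : Matrix (C' × B') (C × B) ℂ} (hV : IsContraction V)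
    (ψ : A × C × B → ℂ) : vecNorm (applyBob V ψ) ≤ vecNorm ψ := by
  refine vecNorm_le_of_sq_le ?_
  rw [Fintype.sum_prod_type, Fintype.sum_prod_type]
  exact Finset.sum_le_sum fun a _ => hV.sum_sq_le fun p => ψ (a, p)

theorem vecNorm_actFst_le {D : Matrix A A ℂ} (hD : IsContraction D)
    (ψ : A × C × B → ℂ) : vecNorm (actFst D ψ) ≤ vecNorm ψ := by
  refine vecNorm_le_of_sq_le ?_
  rw [sum_swap, sum_swap]
  exact Finset.sum_le_sum fun q _ => hD.sum_sq_le fun a => ψ (a, q)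

theorem vecNorm_actThd_le {E : Matrix B B ℂ} (hE : IsContraction E)
    (ψ : A × C × B → ℂ) : vecNorm (actThd E ψ) ≤ vecNorm ψ := by
  refine vecNorm_le_of_sq_le ?_
  simp only [Fintype.sum_prod_type]
  exact Finset.sum_le_sum fun a _ => Finset.sum_le_sum fun c _ =>
    hE.sum_sq_le fun b => ψ (a, c, b)

theorem sum_sq_applyAlice {U : Matrix (A' × C') (A × C) ℂ} [DecidableEq A] [DecidableEq C]
    (hU : Uᴴ * U = 1) (ψ : A × C × B → ℂ) :
    ∑ g, ‖applyAlice U ψ g‖ ^ 2 = ∑ g, ‖ψ g‖ ^ 2 := by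
  rw [sum_rotate, sum_rotate]
  exact Finset.sum_congr rfl fun b _ => sum_sq_mulVec_of_isometry hU fun p => ψ (p.1, p.2, b)

theorem sum_sq_applyBob {V : Matrix (C' × B') (C × B) ℂ} [DecidableEq B] [DecidableEq C]
    (hV : Vᴴ * V = 1) (ψ : A × C × B → ℂ) :
    ∑ g, ‖applyBob V ψ g‖ ^ 2 = ∑ g, ‖ψ g‖ ^ 2 := by
  rw [Fintype.sum_prod_type, Fintype.sum_prod_type]
  exact Finset.sum_congr rfl fun a _ => sum_sq_mulVec_of_isometry hV fun p => ψ (a, p)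

/-! ### Marginals of a vector of `ACB` -/

/-- The matrix of a vector of `ACB` seen as an operator from `A` to `BC`. -/
def bobMatrix (ψ : A × C × B → ℂ) : Matrix (B × C) A ℂ := fun l a => ψ (a, l.2, l.1)

/-- The matrix of a vector of `ACB` seen as an operator from `B` to `AC`. -/
def aliceMatrix (ψ : A × C × B → ℂ) : Matrix (A × C) B ℂ := fun l b => ψ (l.1, l.2, b)

/-- The marginal of a vector of `ACB` on `BC`. -/
def bobReduced (ψ : A × C × B → ℂ) : Matrix (B × C) (B × C) ℂ := bobMatrix ψ * (bobMatrix ψ)ᴴ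

/-- The marginal of a vector of `ACB` on `AC`. -/
def aliceReduced (ψ : A × C × B → ℂ) : Matrix (A × C) (A × C) ℂ :=
  aliceMatrix ψ * (aliceMatrix ψ)ᴴ

theorem trace_bobReduced (ψ : A × C × B → ℂ) :
    trace (bobReduced ψ) = ((∑ g, ‖ψ g‖ ^ 2 : ℝ) : ℂ) := by
  have h : ∑ g, ‖ψ g‖ ^ 2 = ∑ l : B × C, ∑ a, ‖bobMatrix ψ l a‖ ^ 2 := by
    rw [sum_rotate, Fintype.sum_prod_type]
    refine Finset.sum_congr rfl fun b _ => ?_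
    rw [Fintype.sum_prod_type, Finset.sum_comm]
    rfl
  rw [h, trace, Complex.ofReal_sum]
  refine Finset.sum_congr rfl fun l _ => ?_
  rw [diag_apply, bobReduced, Matrix.mul_apply, Complex.ofReal_sum]
  refine Finset.sum_congr rfl fun a _ => ?_
  rw [conjTranspose_apply, RCLike.star_def, Complex.mul_conj', Complex.ofReal_pow]

theorem trace_aliceReduced (ψ : A × C × B → ℂ) :
    trace (aliceReduced ψ) = ((∑ g, ‖ψ g‖ ^ 2 : ℝ) : ℂ) := by
  have h : ∑ g, ‖ψ g‖ ^ 2 = ∑ l : A × C, ∑ b, ‖aliceMatrix ψ l b‖ ^ 2 := by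
    simp only [Fintype.sum_prod_type]
    rfl
  rw [h, trace, Complex.ofReal_sum]
  refine Finset.sum_congr rfl fun l _ => ?_
  rw [diag_apply, aliceReduced, Matrix.mul_apply, Complex.ofReal_sum]
  refine Finset.sum_congr rfl fun a _ => ?_
  rw [conjTranspose_apply, RCLike.star_def, Complex.mul_conj', Complex.ofReal_pow]

/-- Alice's register purifies that of Bob and the message, so she can imitate a change of her input
up to what the others can notice. -/
theorem exists_actFst_le [DecidableEq A] [DecidableEq B] [DecidableEq C] (ψ φ : A × C × B → ℂ) :
    ∃ D : Matrix A A ℂ, IsContraction D ∧ vecNorm (actFst D ψ - φ) ≤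
      hsNorm (cfc Real.sqrt (bobReduced ψ) - cfc Real.sqrt (bobReduced φ)) := by
  obtain ⟨D, hD, h⟩ := exists_contraction_hsNorm_le (bobMatrix ψ) (bobMatrix φ)
  refine ⟨D, hD, le_trans (vecNorm_le_of_sq_le (le_of_eq ?_)) h⟩
  rw [sum_rotate]
  simp only [Fintype.sum_prod_type]
  refine Finset.sum_congr rfl fun b _ => ?_
  rw [Finset.sum_comm]
  refine Finset.sum_congr rfl fun c _ => Finset.sum_congr rfl fun a _ => ?_
  simp only [Pi.sub_apply, Matrix.sub_apply, actFst, Matrix.mul_apply, bobMatrix,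
    transpose_apply, mul_comm]

theorem exists_actThd_le [DecidableEq A] [DecidableEq B] [DecidableEq C] (ψ φ : A × C × B → ℂ) :
    ∃ E : Matrix B B ℂ, IsContraction E ∧ vecNorm (actThd E ψ - φ) ≤
      hsNorm (cfc Real.sqrt (aliceReduced ψ) - cfc Real.sqrt (aliceReduced φ)) := by
  obtain ⟨D, hD, h⟩ := exists_contraction_hsNorm_le (aliceMatrix ψ) (aliceMatrix φ)
  refine ⟨D, hD, le_trans (vecNorm_le_of_sq_le (le_of_eq ?_)) h⟩
  simp only [Fintype.sum_prod_type]
  refine Finset.sum_congr rfl fun a _ => Finset.sum_congr rfl fun c _ =>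
    Finset.sum_congr rfl fun b _ => ?_
  simp only [Pi.sub_apply, Matrix.sub_apply, actThd, Matrix.mul_apply, aliceMatrix,
    transpose_apply, mul_comm]

end Local

section CutAndPaste

open Matrix

variable {X Y : Type*} {t : ℕ} (P : Protocol X Y t)

/-! ### Cut and paste -/

/-- The Hellinger distance of Bob's qubits after round `2j+1` on the inputs `(x, y)`, `(x', y)`. -/
def bobDist (j : ℕ) (x x' : X) (y : Y) : ℝ :=
  hsNorm (cfc Real.sqrt (bobReduced (P.oddState j x y)) -
    cfc Real.sqrt (bobReduced (P.oddState j x' y)))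

/-- The Hellinger distance of Alice's qubits after round `2j+2` on the inputs `(x, y)`,
`(x, y')`. -/
def aliceDist (j : ℕ) (x : X) (y y' : Y) : ℝ :=
  hsNorm (cfc Real.sqrt (aliceReduced (P.evenState x y (j + 1))) -
    cfc Real.sqrt (aliceReduced (P.evenState x y' (j + 1))))

theorem sum_sq_evenState (x : X) (y : Y) {j : ℕ} (hj : j ≤ t / 2) :
    ∑ g, ‖P.evenState x y j g‖ ^ 2 = 1 := by
  induction j with
  | zero =>
    have := P.shared_unit
    rw [← this, Fintype.sum_prod_type, Fintype.sum_prod_type]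
    refine Finset.sum_congr rfl fun a _ => ?_
    rw [Fintype.sum_prod_type]
    -- The initial message register is one-dimensional, so summing over it has no effect.
    have : Subsingleton (Fin (P.dimC 0)) := by rw [P.dimC_zero]; infer_instance
    have c0 : Fin (P.dimC 0) := Fin.cast P.dimC_zero.symm 0
    rw [Fintype.sum_subsingleton _ c0]
    rfl
  | succ j ih =>
    have hj' : j < t / 2 := hj
    rw [evenState, sum_sq_applyBob (P.V_unitary j hj' y).1,
      sum_sq_applyAlice (P.U_unitary j hj' x).1, ih hj'.le]

theorem sum_sq_oddState (x : X) (y : Y) {j : ℕ} (hj : j < t / 2) :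
    ∑ g, ‖P.oddState j x y g‖ ^ 2 = 1 := by
  rw [oddState, sum_sq_applyAlice (P.U_unitary j hj x).1, P.sum_sq_evenState x y hj.le]

/-- The invariant is the sum of the errors at three corners. In one double round the new error at
`(u, p)` absorbs all three old errors plus both new distances. The other two corners cost one new
distance each, whence the factor `2`. This works because each party's correction commutes with the
other's unitary. -/
theorem cut_and_paste (u v : X) (p w : Y) {j : ℕ} (hj : j ≤ t / 2) :
    ∃ D E, IsContraction D ∧ IsContraction E ∧
      vecNorm (P.evenState u p j - actThd E (actFst D (P.evenState v w j))) +
        vecNorm (actFst D (P.evenState v w j) - P.evenState u w j) +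
        vecNorm (actThd E (P.evenState v w j) - P.evenState v p j) ≤
      2 * ∑ i ∈ Finset.range j, (P.bobDist i v u w + P.aliceDist i v w p) := by
  induction j with
  | zero =>
    -- The shared state does not depend on the inputs.
    refine ⟨1, 1, isContraction_one, isContraction_one, ?_⟩
    have h0 : ∀ x y, P.evenState x y 0 = P.evenState u p 0 := fun _ _ => rfl
    rw [actFst_one, actThd_one, h0 v w, h0 u w, h0 v p]
    simp only [vecNorm_sub_self, Finset.range_zero, Finset.sum_empty]
    norm_num
  | succ j ih =>
    have hj' : j < t / 2 := hj
    obtain ⟨D, E, -, hE, hDE⟩ := ih hj'.le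
    -- `D'` is chosen after Alice's round, through which `E` persists; `E'` is chosen after Bob's
    -- round, through which `D'` persists.
    obtain ⟨D', hD', hdD⟩ := exists_actFst_le (P.oddState j v w) (P.oddState j u w)
    obtain ⟨E', hE', hdE⟩ := exists_actThd_le (P.evenState v w (j + 1)) (P.evenState v p (j + 1))
    have hU : ∀ x, IsContraction (P.U j x) := fun x =>
      isContraction_of_isometry (P.U_unitary j hj' x).1
    have hV : ∀ y, IsContraction (P.V j y) := fun y =>
      isContraction_of_isometry (P.V_unitary j hj' y).1
    change vecNorm _ ≤ P.bobDist j v u w at hdD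
    change vecNorm _ ≤ P.aliceDist j v w p at hdE
    have odd_eq : ∀ x y, P.oddState j x y = applyAlice (P.U j x) (P.evenState x y j) :=
      fun _ _ => rfl
    have even_eq : ∀ x y, P.evenState x y (j + 1) = applyBob (P.V j y) (P.oddState j x y) :=
      fun _ _ => rfl
    refine ⟨D', E', hD', hE', ?_⟩
    -- after Alice's round
    have o1 : vecNorm (P.oddState j u p -
        actThd E (applyAlice (P.U j u) (actFst D (P.evenState v w j)))) ≤
        vecNorm (P.evenState u p j - actThd E (actFst D (P.evenState v w j))) := by
      rw [odd_eq, actThd_applyAlice, ← applyAlice_sub]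
      exact vecNorm_applyAlice_le (hU u) _
    have o2 : vecNorm (actThd E (applyAlice (P.U j u) (actFst D (P.evenState v w j))) -
        actThd E (P.oddState j u w)) ≤
        vecNorm (actFst D (P.evenState v w j) - P.evenState u w j) := by
      rw [odd_eq, ← actThd_sub, ← applyAlice_sub]
      exact (vecNorm_actThd_le hE _).trans (vecNorm_applyAlice_le (hU u) _)
    have o3 : vecNorm (actThd E (P.oddState j u w) - actThd E (actFst D' (P.oddState j v w))) ≤
        P.bobDist j v u w := by
      rw [← actThd_sub]
      refine (vecNorm_actThd_le hE _).trans ?_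
      rwa [vecNorm_sub_comm]
    have o4 : vecNorm (actThd E (P.oddState j v w) - P.oddState j v p) ≤
        vecNorm (actThd E (P.evenState v w j) - P.evenState v p j) := by
      rw [odd_eq, odd_eq, actThd_applyAlice, ← applyAlice_sub]
      exact vecNorm_applyAlice_le (hU v) _
    -- after Bob's round
    have e1 : vecNorm (P.evenState u p (j + 1) -
        applyBob (P.V j p) (actThd E (actFst D' (P.oddState j v w)))) ≤
        vecNorm (P.oddState j u p - actThd E (actFst D' (P.oddState j v w))) := by
      rw [even_eq, ← applyBob_sub]
      exact vecNorm_applyBob_le (hV p) _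
    have e2 : vecNorm (applyBob (P.V j p) (actThd E (actFst D' (P.oddState j v w))) -
        actFst D' (P.evenState v p (j + 1))) ≤
        vecNorm (actThd E (P.oddState j v w) - P.oddState j v p) := by
      rw [even_eq, ← actFst_actThd, ← actFst_applyBob, ← actFst_sub, ← applyBob_sub]
      exact (vecNorm_actFst_le hD' _).trans (vecNorm_applyBob_le (hV p) _)
    have e3 : vecNorm (actFst D' (P.evenState v p (j + 1)) -
        actThd E' (actFst D' (P.evenState v w (j + 1)))) ≤ P.aliceDist j v w p := by
      rw [← actFst_actThd, ← actFst_sub]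
      refine (vecNorm_actFst_le hD' _).trans ?_
      rwa [vecNorm_sub_comm]
    have e4 : vecNorm (actFst D' (P.evenState v w (j + 1)) - P.evenState u w (j + 1)) ≤
        P.bobDist j v u w := by
      rw [even_eq, even_eq, actFst_applyBob, ← applyBob_sub]
      exact (vecNorm_applyBob_le (hV w) _).trans hdD
    have t1 := vecNorm_sub_le (P.oddState j u p)
      (actThd E (applyAlice (P.U j u) (actFst D (P.evenState v w j)))) (actThd E (P.oddState j u w))
    have t2 := vecNorm_sub_le (P.oddState j u p) (actThd E (P.oddState j u w))
      (actThd E (actFst D' (P.oddState j v w)))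
    have t3 := vecNorm_sub_le (P.evenState u p (j + 1))
      (applyBob (P.V j p) (actThd E (actFst D' (P.oddState j v w))))
      (actFst D' (P.evenState v p (j + 1)))
    have t4 := vecNorm_sub_le (P.evenState u p (j + 1)) (actFst D' (P.evenState v p (j + 1)))
      (actThd E' (actFst D' (P.evenState v w (j + 1))))
    rw [Finset.sum_range_succ]
    linarith

/-! ### Output probabilities -/

/-- Acceptance probabilities become squared norms, to which the triangle inequality applies. -/
theorem trace_aliceReduced_mul {A B C : Type*} [Fintype A] [Fintype B] [Fintype C]
    (R : Matrix (A × C) (A × C) ℂ) (ψ : A × C × B → ℂ) :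
    (trace (aliceReduced ψ * (Rᴴ * R))).re = vecNorm (applyAlice R ψ) ^ 2 := by
  have h : aliceMatrix (applyAlice R ψ) = R * aliceMatrix ψ := by
    ext p b
    simp only [aliceMatrix, applyAlice, Matrix.mul_apply]
  have h2 := trace_aliceReduced (applyAlice R ψ)
  rw [vecNorm_sq, ← Complex.ofReal_re (∑ g, ‖applyAlice R ψ g‖ ^ 2), ← h2, aliceReduced,
    aliceReduced, h, conjTranspose_mul, ← Matrix.mul_assoc, trace_mul_comm]
  simp only [Matrix.mul_assoc]

theorem exists_sqrt_measurement {K : Type*} [Fintype K] [DecidableEq K] {M : Matrix K K ℂ}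
    (h0 : M.PosSemidef) (h1 : (1 - M).PosSemidef) :
    ∃ R : Matrix K K ℂ, IsContraction R ∧ Rᴴ * R = M := by
  have hR : (cfc Real.sqrt M)ᴴ * cfc Real.sqrt M = M := by
    rw [(cfc_isHermitian _ M).eq,
      ← cfc_mul _ _ M (continuousOn_spectrum _ _) (continuousOn_spectrum _ _)]
    conv_rhs => rw [← cfc_id' ℝ M h0.1.isSelfAdjoint]
    exact cfc_congr fun x hx => Real.mul_self_sqrt (spectrum_nonneg h0 hx)
  exact ⟨cfc Real.sqrt M, isContraction_of_conjTranspose_mul_self_le (hR.symm ▸ h1), hR⟩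

/-- Bob's contraction commutes with Alice's measurement and cannot raise her acceptance amplitude.
The gap between the amplitudes on `(u, p)` and `(u, w)` must therefore come from the cut-and-paste
error. -/
theorem one_fifth_le (u v : X) (p w : Y) (hup : P.outputProb u p false ≤ 1 / 3)
    (huw : P.outputProb u w true ≤ 1 / 3) :
    1 / 5 ≤ 2 * ∑ i ∈ Finset.range (t / 2), (P.bobDist i v u w + P.aliceDist i v w p) := by
  obtain ⟨D, E, hD, hE, h⟩ := P.cut_and_paste u v p w le_rfl
  refine le_trans ?_ h
  obtain ⟨R, hR, hRM⟩ := exists_sqrt_measurement (P.M_nonneg u) (P.M_le_one u)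
  have hfin : ∀ y, P.finalState u y = aliceReduced (P.evenState u y (t / 2)) := fun y => by
    ext p q
    simp only [finalState, aliceReduced, aliceMatrix, Matrix.mul_apply, conjTranspose_apply]
  have hM : ∀ y, (trace (P.finalState u y * P.M u)).re =
      vecNorm (applyAlice R (P.evenState u y (t / 2))) ^ 2 := fun y => by
    rw [hfin, ← hRM, trace_aliceReduced_mul]
  have h1 : (2 / 3 : ℝ) ≤ vecNorm (applyAlice R (P.evenState u p (t / 2))) ^ 2 := by
    have htr : (trace (P.finalState u p)).re = 1 := by
      rw [hfin, trace_aliceReduced, P.sum_sq_evenState u p le_rfl]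
      rfl
    have : P.outputProb u p false = (trace (P.finalState u p * (1 - P.M u))).re := by
      simp [outputProb]
    rw [this, Matrix.mul_sub, mul_one, trace_sub, Complex.sub_re, htr, hM] at hup
    linarith
  have h2 : vecNorm (applyAlice R (P.evenState u w (t / 2))) ^ 2 ≤ 1 / 3 := by
    have : P.outputProb u w true = (trace (P.finalState u w * P.M u)).re := by
      simp [outputProb]
    rwa [this, hM] at huw
  have s1 := vecNorm_sub_le (P.evenState u p (t / 2))
    (actThd E (actFst D (P.evenState v w (t / 2)))) (actThd E (P.evenState u w (t / 2)))
  have s2 : vecNorm (actThd E (actFst D (P.evenState v w (t / 2))) -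
      actThd E (P.evenState u w (t / 2))) ≤
      vecNorm (actFst D (P.evenState v w (t / 2)) - P.evenState u w (t / 2)) := by
    rw [← actThd_sub]
    exact vecNorm_actThd_le hE _
  have s3 : vecNorm (applyAlice R (P.evenState u p (t / 2)) -
      applyAlice R (actThd E (P.evenState u w (t / 2)))) ≤
      vecNorm (P.evenState u p (t / 2) - actThd E (P.evenState u w (t / 2))) := by
    rw [← applyAlice_sub]
    exact vecNorm_applyAlice_le hR _
  have s4 : vecNorm (applyAlice R (actThd E (P.evenState u w (t / 2)))) ≤
      vecNorm (applyAlice R (P.evenState u w (t / 2))) := by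
    rw [← actThd_applyAlice]
    exact vecNorm_actThd_le hE _
  have s5 := vecNorm_le_add (applyAlice R (P.evenState u p (t / 2)))
    (applyAlice R (actThd E (P.evenState u w (t / 2))))
  have s6 := vecNorm_nonneg (actThd E (P.evenState v w (t / 2)) - P.evenState v p (t / 2))
  have n1 := vecNorm_nonneg (applyAlice R (P.evenState u p (t / 2)))
  have n2 := vecNorm_nonneg (applyAlice R (P.evenState u w (t / 2)))
  -- Rational bounds: `(4/5)² ≤ 2/3` and `1/3 ≤ (3/5)²`.
  have k1 : 4 / 5 ≤ vecNorm (applyAlice R (P.evenState u p (t / 2))) := by nlinarith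
  have k2 : vecNorm (applyAlice R (P.evenState u w (t / 2))) ≤ 3 / 5 := by nlinarith
  linarith

end CutAndPaste

section Cost

open Matrix

variable {X Y : Type*} [Fintype X] [DecidableEq X] [Fintype Y] [DecidableEq Y]

/-! ### The Holevo information cost under a uniform distribution -/

/-- Tracing out the copies `R_X` and `R_Y` removes all coherence between different inputs. -/
theorem bobMarginal_globalState {A B C : Type*} [Fintype A] [Fintype B] [Fintype C]
    [DecidableEq B] [DecidableEq C] {c : ℝ} (hc : 0 ≤ c)
    {μ : X → Y → ℝ} (hμ : ∀ x y, μ x y = c) (Θ : X → Y → A × C × B → ℂ) :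
    bobMarginal (pureDensity (globalState μ Θ)) = cqState c fun x y => bobReduced (Θ x y) := by
  ext p q
  obtain ⟨x, ⟨b, d⟩, y⟩ := p
  obtain ⟨x', ⟨b', d'⟩, y'⟩ := q
  simp only [bobMarginal, pureDensity, vecMulVec_apply, Pi.star_apply, globalState, hμ]
  rw [Finset.sum_eq_single x, Finset.sum_eq_single y]
  · by_cases h : x = x' ∧ y = y'
    · obtain ⟨rfl, rfl⟩ := h
      have hs : ((√c : ℝ) : ℂ) * ((√c : ℝ) : ℂ) = (c : ℂ) := by
        rw [← Complex.ofReal_mul, Real.mul_self_sqrt hc]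
      simp only [cqState, and_self, if_true, bobReduced, Matrix.mul_apply, bobMatrix,
        conjTranspose_apply, Finset.mul_sum, ← hs]
      refine Finset.sum_congr rfl fun a _ => ?_
      rw [star_mul', RCLike.star_def, Complex.conj_ofReal]
      ring
    · simp [cqState, h]
  · intro r _ hr
    simp [hr]
  · simp
  · intro r _ hr
    simp [hr]
  · simp

theorem aliceMarginal_globalState {A B C : Type*} [Fintype A] [Fintype B] [Fintype C]
    [DecidableEq A] [DecidableEq C] {c : ℝ} (hc : 0 ≤ c)
    {μ : X → Y → ℝ} (hμ : ∀ x y, μ x y = c) (Θ : X → Y → A × C × B → ℂ) :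
    aliceMarginal (pureDensity (globalState μ Θ)) =
      cqState c fun y x => aliceReduced (Θ x y) := by
  ext p q
  obtain ⟨y, ⟨a, d⟩, x⟩ := p
  obtain ⟨y', ⟨a', d'⟩, x'⟩ := q
  simp only [aliceMarginal, pureDensity, vecMulVec_apply, Pi.star_apply, globalState, hμ]
  rw [Finset.sum_eq_single x, Finset.sum_eq_single y]
  · by_cases h : y = y' ∧ x = x'
    · obtain ⟨rfl, rfl⟩ := h
      have hs : ((√c : ℝ) : ℂ) * ((√c : ℝ) : ℂ) = (c : ℂ) := by
        rw [← Complex.ofReal_mul, Real.mul_self_sqrt hc]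
      simp only [cqState, and_self, if_true, aliceReduced, Matrix.mul_apply, aliceMatrix,
        conjTranspose_apply, Finset.mul_sum, ← hs]
      refine Finset.sum_congr rfl fun a _ => ?_
      rw [star_mul', RCLike.star_def, Complex.conj_ofReal]
      ring
    · have h' : ¬(x = x' ∧ y = y') := fun h' => h h'.symm
      simp [cqState, h, h']
  · intro r _ hr
    simp [hr]
  · simp
  · intro r _ hr
    simp [hr]
  · simp

variable {t : ℕ} (P : Protocol X Y t)

/-- The Hellinger distance of Bob's qubits after round `2j+1` from their average over `X`. -/
def bobSpread (j : ℕ) (x : X) (y : Y) : ℝ :=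
  hsNorm (cfc Real.sqrt (bobReduced (P.oddState j x y)) -
    cfc Real.sqrt (ensembleMean (fun x y => bobReduced (P.oddState j x y)) y))

/-- The Hellinger distance of Alice's qubits after round `2j+2` from their average over `Y`. -/
def aliceSpread (j : ℕ) (x : X) (y : Y) : ℝ :=
  hsNorm (cfc Real.sqrt (aliceReduced (P.evenState x y (j + 1))) -
    cfc Real.sqrt (ensembleMean (fun y x => aliceReduced (P.evenState x y (j + 1))) x))

theorem bobSpread_nonneg (j : ℕ) (x : X) (y : Y) : 0 ≤ P.bobSpread j x y := hsNorm_nonneg _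

theorem aliceSpread_nonneg (j : ℕ) (x : X) (y : Y) : 0 ≤ P.aliceSpread j x y := hsNorm_nonneg _

theorem bobDist_le (j : ℕ) (x x' : X) (y : Y) :
    P.bobDist j x x' y ≤ P.bobSpread j x y + P.bobSpread j x' y := by
  unfold bobDist bobSpread
  refine (hsNorm_sub_le _ (cfc Real.sqrt
    (ensembleMean (fun x y => bobReduced (P.oddState j x y)) y)) _).trans ?_
  rw [hsNorm_sub_comm (cfc Real.sqrt (ensembleMean _ _))]

theorem aliceDist_le (j : ℕ) (x : X) (y y' : Y) :
    P.aliceDist j x y y' ≤ P.aliceSpread j x y + P.aliceSpread j x y' := by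
  unfold aliceDist aliceSpread
  refine (hsNorm_sub_le _ (cfc Real.sqrt
    (ensembleMean (fun y x => aliceReduced (P.evenState x y (j + 1))) x)) _).trans ?_
  rw [hsNorm_sub_comm (cfc Real.sqrt (ensembleMean _ _))]

theorem sum_spread_sq_le_HQIC [Nonempty X] [Nonempty Y] {c : ℝ} (hc : 0 ≤ c)
    {μ : X → Y → ℝ} (hμ : ∀ x y, μ x y = c) :
    c * ∑ j ∈ Finset.range (t / 2), ∑ x, ∑ y,
      (P.bobSpread j x y ^ 2 + P.aliceSpread j x y ^ 2) ≤ P.HQIC μ := by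
  simp only [Finset.sum_add_distrib, mul_add]
  refine add_le_add ?_ ?_
  · rw [Finset.mul_sum]
    refine Finset.sum_le_sum fun j hj => ?_
    rw [bobMarginal_globalState hc hμ]
    refine sum_hsNorm_sq_le_condMutualInfo
      (ρ := fun x y => bobReduced (P.oddState j x y))
      (fun x y => posSemidef_self_mul_conjTranspose _) (fun x y => ?_) hc
    rw [trace_bobReduced, P.sum_sq_oddState x y (Finset.mem_range.1 hj), Complex.ofReal_one]
  · rw [Finset.mul_sum]
    refine Finset.sum_le_sum fun j hj => ?_
    rw [aliceMarginal_globalState hc hμ, Finset.sum_comm]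
    refine sum_hsNorm_sq_le_condMutualInfo
      (ρ := fun y x => aliceReduced (P.evenState x y (j + 1)))
      (fun y x => posSemidef_self_mul_conjTranspose _) (fun y x => ?_) hc
    rw [trace_aliceReduced, P.sum_sq_evenState x y (Finset.mem_range.1 hj), Complex.ofReal_one]

theorem outputProb_le_err (F : X → Y → Bool) (x : X) (y : Y) :
    P.outputProb x y (!F x y) ≤ P.err F :=
  le_ciSup (f := fun p : X × Y => P.outputProb p.1 p.2 (!F p.1 p.2))
    (Set.finite_range _).bddAbove (x, y)

end Cost

/-! ### Averaging over input triples and Cauchy–Schwarz -/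

section Equality

variable {S : Type*} [Fintype S] [DecidableEq S] {t : ℕ}

/-- Averaging an inequality over triples `u`, `v`, `w` with `u ≠ w`. -/
theorem card_sq_le_sum_of_triples [Nontrivial S] {a b : S → S → ℝ} (ha : ∀ x y, 0 ≤ a x y)
    (hb : ∀ x y, 0 ≤ b x y)
    (h : ∀ u v w, u ≠ w → 1 / 5 ≤ 2 * (a v w + a u w + (b v w + b v u))) :
    (Fintype.card S : ℝ) ^ 2 / 40 ≤ ∑ x, ∑ y, (a x y + b x y) := by
  have hN : (2 : ℝ) ≤ Fintype.card S := by exact_mod_cast Fintype.one_lt_card (α := S)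
  set N : ℝ := (Fintype.card S : ℝ) with hNdef
  -- Triples with `u = w` receive the trivial bound `0`, so that the sum runs over all triples and
  -- factorizes.
  have key : ∀ u v w : S, (1 / 5 - if u = w then (1 / 5 : ℝ) else 0) ≤
      2 * (a v w + a u w + (b v w + b v u)) := by
    intro u v w
    split_ifs with huw
    · rw [sub_self]
      exact mul_nonneg zero_le_two
        (add_nonneg (add_nonneg (ha _ _) (ha _ _)) (add_nonneg (hb _ _) (hb _ _)))
    · rw [sub_zero]
      exact h u v w huw
  have hsum := Finset.sum_le_sum fun u (_ : u ∈ (Finset.univ : Finset S)) =>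
    Finset.sum_le_sum fun v (_ : v ∈ (Finset.univ : Finset S)) =>
      Finset.sum_le_sum fun w (_ : w ∈ (Finset.univ : Finset S)) => key u v w
  simp only [← Finset.mul_sum, Finset.sum_add_distrib, Finset.sum_sub_distrib, Finset.sum_ite_eq,
    Finset.mem_univ, if_true, Finset.sum_const, Finset.card_univ, nsmul_eq_mul, ← hNdef] at hsum
  rw [Finset.sum_comm (f := fun u v => b v u)] at hsum
  simp only [Finset.sum_add_distrib]
  set A := ∑ x, ∑ y, a x y
  set B := ∑ x, ∑ y, b x y
  have hN0 : 0 < N := by linarith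
  -- Each of the four terms omits one variable and contributes `N * A` or `N * B`. Then `N - 1 ≥ N /
  -- 2` gives the constant `40`.
  have h3 : N * (N - 1) * (1 / 5) ≤ 4 * (A + B) := by
    refine le_of_mul_le_mul_left ?_ hN0
    linarith
  nlinarith

/-- A protocol that recognizes equality has a large average spread. -/
theorem card_sq_le_sum_spread [Nontrivial S] (P : Protocol S S t)
    (heq : ∀ x, P.outputProb x x false ≤ 1 / 3)
    (hne : ∀ x y, x ≠ y → P.outputProb x y true ≤ 1 / 3) :
    (Fintype.card S : ℝ) ^ 2 / 40 ≤
      ∑ j ∈ Finset.range (t / 2), ∑ x, ∑ y, (P.bobSpread j x y + P.aliceSpread j x y) := by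
  have h := card_sq_le_sum_of_triples
    (a := fun x y => ∑ j ∈ Finset.range (t / 2), P.bobSpread j x y)
    (b := fun x y => ∑ j ∈ Finset.range (t / 2), P.aliceSpread j x y)
    (fun x y => Finset.sum_nonneg fun j _ => P.bobSpread_nonneg j x y)
    (fun x y => Finset.sum_nonneg fun j _ => P.aliceSpread_nonneg j x y)
    (fun u v w huw => by
      -- The rectangle has `p = u`: its corner `(u, u)` must be accepted and `(u, w)` rejected.
      refine (P.one_fifth_le u v u w (heq u) (hne u w huw)).trans ?_
      simp only [← Finset.sum_add_distrib]
      exact mul_le_mul_of_nonneg_left (Finset.sum_le_sum fun j _ =>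
        add_le_add (P.bobDist_le j v u w) (P.aliceDist_le j v w u)) zero_le_two)
  refine h.trans (le_of_eq ?_)
  simp only [← Finset.sum_add_distrib]
  exact ((Finset.sum_congr rfl fun x _ => Finset.sum_comm).trans Finset.sum_comm)

/-- Cauchy–Schwarz over at most `t / 2 * N²` terms, with `N` the number of inputs of each party; the
bound `(a + b)² ≤ 2 (a² + b²)` supplies the missing factor `2`. -/
theorem sq_sum_spread_le (P : Protocol S S t) :
    (∑ j ∈ Finset.range (t / 2), ∑ x, ∑ y, (P.bobSpread j x y + P.aliceSpread j x y)) ^ 2 ≤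
      t * (Fintype.card S : ℝ) ^ 2 * ∑ j ∈ Finset.range (t / 2), ∑ x, ∑ y,
        (P.bobSpread j x y ^ 2 + P.aliceSpread j x y ^ 2) := by
  have h := sq_sum_le_card_mul_sum_sq (s := Finset.range (t / 2) ×ˢ (Finset.univ : Finset (S × S)))
    (f := fun z => P.bobSpread z.1 z.2.1 z.2.2 + P.aliceSpread z.1 z.2.1 z.2.2)
  simp only [Finset.sum_product, Fintype.sum_prod_type, Finset.card_product, Finset.card_range,
    Finset.card_univ, Fintype.card_prod] at h
  refine h.trans ?_
  have h2 : ∑ j ∈ Finset.range (t / 2), ∑ x, ∑ y, (P.bobSpread j x y + P.aliceSpread j x y) ^ 2 ≤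
      2 * ∑ j ∈ Finset.range (t / 2), ∑ x, ∑ y,
        (P.bobSpread j x y ^ 2 + P.aliceSpread j x y ^ 2) := by
    simp only [Finset.mul_sum]
    exact Finset.sum_le_sum fun j _ => Finset.sum_le_sum fun x _ => Finset.sum_le_sum fun y _ =>
      add_sq_le
  have h3 : ((t / 2 : ℕ) : ℝ) ≤ t / 2 := Nat.cast_div_le
  have h4 : 0 ≤ ∑ j ∈ Finset.range (t / 2), ∑ x, ∑ y,
      (P.bobSpread j x y ^ 2 + P.aliceSpread j x y ^ 2) :=
    Finset.sum_nonneg fun j _ => Finset.sum_nonneg fun x _ => Finset.sum_nonneg fun y _ => by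
      positivity
  push_cast
  refine (mul_le_mul_of_nonneg_left h2 (by positivity)).trans ?_
  set Q := ∑ j ∈ Finset.range (t / 2), ∑ x, ∑ y,
    (P.bobSpread j x y ^ 2 + P.aliceSpread j x y ^ 2)
  have h5 := mul_le_mul_of_nonneg_right h3
    (mul_nonneg (sq_nonneg (Fintype.card S : ℝ)) h4)
  linarith

end Equality

end Protocol

end QComm

end

theorem mainTheorem5 (t k : ℕ) (ht : 0 < t) (hk : 0 < k)
    (P : QComm.Protocol (Fin k → Bool) (Fin k → Bool) t)
    (herr : P.err (QComm.equality k) ≤ 1 / 3) :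
    P.HQIC (QComm.tensorPow QComm.uniformBits k) ≥ 1 / (40000 * (t : ℝ)) := by
  -- For `k ≥ 1` there are at least two strings, hence a pair of unequal inputs.
  have : Nonempty (Fin k) := ⟨⟨0, hk⟩⟩
  have h1 := P.card_sq_le_sum_spread
    (fun x => by
      have := (P.outputProb_le_err (QComm.equality k) x x).trans herr
      simpa [QComm.equality] using this)
    (fun x y hxy => by
      have := (P.outputProb_le_err (QComm.equality k) x y).trans herr
      simpa [QComm.equality, hxy] using this)
  have h2 := P.sq_sum_spread_le
  have h3 := P.sum_spread_sq_le_HQIC (c := (1 / 4) ^ k) (by positivity)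
    (μ := QComm.tensorPow QComm.uniformBits k)
    (fun x y => by simp [QComm.tensorPow, QComm.uniformBits])
  -- The weight `c = 4⁻ᵏ` of an input pair cancels the number `N² = 4ᵏ` of pairs, so the bound does
  -- not depend on `k`.
  have hc : (1 / 4 : ℝ) ^ k * (Fintype.card (Fin k → Bool) : ℝ) ^ 2 = 1 := by
    rw [Fintype.card_fun, Fintype.card_bool, Fintype.card_fin]
    push_cast
    rw [← pow_mul, mul_comm k, pow_mul, ← mul_pow]
    norm_num
  refine le_trans ?_ h3
  set Q := ∑ j ∈ Finset.range (t / 2), ∑ x, ∑ y,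
    (P.bobSpread j x y ^ 2 + P.aliceSpread j x y ^ 2)
  set N : ℝ := (Fintype.card (Fin k → Bool) : ℝ)
  set c : ℝ := (1 / 4) ^ k
  have htr : (0 : ℝ) < t := Nat.cast_pos.2 ht
  have hcp : 0 < c := by positivity
  have hN : 0 < N ^ 2 := by
    by_contra h
    nlinarith
  have h4 : (N ^ 2 / 40) ^ 2 ≤ t * N ^ 2 * Q :=
    (pow_le_pow_left₀ (by positivity) h1 2).trans h2
  have h5 : N ^ 2 / 1600 ≤ t * Q := by
    refine le_of_mul_le_mul_left ?_ hN
    linarith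
  have h6 := mul_le_mul_of_nonneg_left h5 hcp.le
  -- The estimates give `1 ≤ 1600 * t * (c * Q)`, which is stronger than required.
  rw [div_le_iff₀ (by positivity)]
  nlinarith
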